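/- **Event structures.** An event structure $\mathcal E=(E,\le,\#)$ is a set $E$ of events with a partial order $\le$ and an irreflexive symmetric conflict relation $\#$ such that $\{e':e'\le e\}$ is finite for every $e$, and $e\#e'$, $e'\le e''$ imply $e\#e''$. A configuration is a finite, conflict-free, downward-closed subset of $E$; the domain $\mathcal D(\mathcal E)$ is the set of configurations ordered by inclusion. For a configuration $c$, the event structure $\mathcal E\setminus c$ rooted at $c$ is the restriction of $\mathcal E$ to the events that are neither in $c$ nor in conflict with an event of $c$. The conflict $e'\#e''$ is minimal ($e'\#_\mu e''$) if there is no event $e\neq e',e''$ with ($e\le e'$ and $e\#e''$) or ($e\le e''$ and $e\#e'$); $e\lessdot e'$ means that $e$ is an immediate predecessor of $e'$. A trace alphabet is a pair $(\Sigma,I)$ of a finite nonempty set $\Sigma$ and an irreflexive symmetric relation $I$ on $\Sigma$; put $D=(\Sigma\times\Sigma)\setminus I$. The event structure $\mathcal E$ is *trace-regular* if for some trace alphabet there is a labeling $\lambda:E\to\Sigma$ such that (1) $e\#_\mu e'$ implies $\lambda(e)\ne\lambda(e')$; (2) $e\lessdot e'$ or $e\#_\mu e'$ implies $(\lambda(e),\lambda(e'))\in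 D$; (3) $(\lambda(e),\lambda(e'))\in D$ implies $e\le e'$, $e'\le e$ or $e\#e'$; and such that the labeled event structures $(\mathcal E\setminus c,\lambda)$, $c\in\mathcal D(\mathcal E)$, fall into finitely many isomorphism classes. **Cube complexes.** A cube complex is *NPC* if the link of each vertex is a flag simplicial complex. Its hyperplanes correspond to the classes of the equivalence relation on edges generated by being opposite edges of a square. Two hyperplanes intersect if they are dual to consecutive edges of some square; they osculate if they are dual to distinct edges with a common end vertex $v$ that are not consecutive edges of a square at $v$. A complex is *special* if its hyperplanes are two-sided, do not self-intersect and do not directly self-osculate (osculate with themselves at two edges both directed towards, or both directed away from, the common vertex, for a consistent direction of the dual edges), and no two distinct hyperplanes both intersect and osculate. A finite NPC complex is *virtually special* if it has a finite special NPC cover. An admissible orientation $o$ of $X$ directs all edges so that opposite edges of each square have the same direction; it lifts to an orientation $\tilde o$ of the universal cover $\widetilde X$. For a vertex $\tilde v$ of $\widetilde X$, the principal filter of $\tilde v$ is the set of vertices reachable from $\tilde v$ by a directed path, ordered by the existence of a directed path. An event structure $\mathcal E$ is *strongly regular* if $\mathcal D(\mathcal E)$ is isomorphic, as a partially ordered set,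 to a principal filter of $(\widetilde X,\tilde o)$ for some finite NPC complex $X$ with an admissible orientation $o$. A strongly regular $\mathcal E$ is *cover-special* if this holds for some virtually special complex $X$ with an admissible orientation $o$. **Corollary.** Every trace-regular event structure is cover-special, and hence strongly regular. -/

import Mathlib

universe u

/-! ### Event structures -/

/-- An event structure on the partially ordered set `E` of events; `≤` is causal dependency. -/
structure EventStructure (E : Type u) [PartialOrder E] where
  /-- the conflict relation -/
  conflict : E → E → Prop
  conflict_irrefl : ∀ e, ¬ conflict e e
  conflict_symm : ∀ e e', conflict e e' → conflict e' e
  finite_causes : ∀ e : E, {e' : E | e' ≤ e}.Finite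
  conflict_inherit : ∀ e e' e'', conflict e e' → e' ≤ e'' → conflict e e''

namespace EventStructure

variable {E : Type u} [PartialOrder E] (S : EventStructure E)

/-- Minimal conflict. -/
def MinConflict (e₁ e₂ : E) : Prop :=
  S.conflict e₁ e₂ ∧
    ¬ ∃ e, e ≠ e₁ ∧ e ≠ e₂ ∧ ((e ≤ e₁ ∧ S.conflict e e₂) ∨ (e ≤ e₂ ∧ S.conflict e e₁))

/-- Configurations: finite, conflict-free, downward-closed sets of events. -/
def IsConfiguration (c : Finset E) : Prop :=
  (∀ e ∈ c, ∀ e' ∈ c, ¬ S.conflict e e') ∧ (∀ e ∈ c, ∀ e', e' ≤ e → e' ∈ c)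

/-- The domain of an event structure: its configurations, ordered by inclusion (the order is the
one inherited from `Finset E`). -/
abbrev Domain : Type u := {c : Finset E // S.IsConfiguration c}

/-- The events of the event structure rooted at `c`: those neither in `c` nor in conflict with an
event of `c`. -/
abbrev Residual (c : S.Domain) : Type u :=
  {e : E // e ∉ c.1 ∧ ¬ ∃ e' ∈ c.1, S.conflict e' e}

/-- The event structure rooted at `c`. -/
def rooted (c : S.Domain) : EventStructure (S.Residual c) where
  conflict e e' := S.conflict e.1 e'.1
  conflict_irrefl e := S.conflict_irrefl e.1
  conflict_symm e e' := S.conflict_symm e.1 e'.1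
  finite_causes e :=
    ((S.finite_causes e.1).preimage Subtype.val_injective.injOn).subset fun _ h => h
  conflict_inherit e e' e'' := S.conflict_inherit e.1 e'.1 e''.1

variable {A : Type} (lab : E → A)

/-- Two configurations are equivalent if the labeled event structures rooted at them are
isomorphic. -/
def labeledFutureSetoid : Setoid S.Domain where
  r c c' := ∃ f : S.Residual c ≃o S.Residual c',
    (∀ e e', (S.rooted c).conflict e e' ↔ (S.rooted c').conflict (f e) (f e')) ∧
      ∀ e, lab (f e).1 = lab e.1
  iseqv :=
    { refl := fun c => ⟨OrderIso.refl _, fun _ _ => Iff.rfl, fun _ => rfl⟩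
      symm := by
        rintro c c' ⟨f, hf, hl⟩
        refine ⟨f.symm, fun e e' => ?_, fun e => ?_⟩
        · rw [hf]; simp
        · rw [← hl]; simp
      trans := by
        rintro c c' c'' ⟨f, hf, hl⟩ ⟨g, hg, hm⟩
        exact ⟨f.trans g, fun e e' => (hf e e').trans (hg _ _), fun e => (hm _).trans (hl e)⟩ }

/-- The labeled event structure has finite index. -/
def HasFiniteLabeledIndex : Prop := Finite (Quotient (S.labeledFutureSetoid lab))

/-- `lab` is a trace labeling of `S` with the trace alphabet `(A, I)`. -/
structure IsTraceLabeling (I : A → A → Prop) : Prop where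
  les1 : ∀ e e', S.MinConflict e e' → lab e ≠ lab e'
  les2 : ∀ e e', e ⋖ e' ∨ S.MinConflict e e' → ¬ I (lab e) (lab e')
  les3 : ∀ e e', ¬ I (lab e) (lab e') → e ≤ e' ∨ e' ≤ e ∨ S.conflict e e'

/-- Trace-regular event structures: there are a trace alphabet `(A, I)`, that is, a finite nonempty
alphabet with an irreflexive symmetric independence relation, and a trace labeling for which the
labeled event structure has finite index. -/
def IsTraceRegular : Prop :=
  ∃ (A : Type) (_ : Finite A) (_ : Nonempty A) (I : A → A → Prop) (lab : E → A),
    (∀ a, ¬ I a a) ∧ (∀ a b, I a b → I b a) ∧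
      S.IsTraceLabeling lab I ∧ S.HasFiniteLabeledIndex lab

end EventStructure

/-! ### Cube complexes -/

/-- A face embedding of the `m`-cube `{0,1}^m` into the `n`-cube `{0,1}^n` (an isometric embedding
onto a face): `base` is the image of the origin, and the `i`-th coordinate direction is sent to
the direction `dir i`, pointing away from `base`. For `m = n` these are the symmetries of the
cube. -/
@[ext]
structure CubeFace (m n : ℕ) where
  dir : Fin m ↪ Fin n
  base : Fin n → Bool

namespace CubeFace

/-- The effect on the vertices of the cube. -/
def map {m n : ℕ} (f : CubeFace m n) (x : Fin m → Bool) : Fin n → Bool :=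
  fun j => xor (f.base j) (decide (∃ i, f.dir i = j ∧ x i = true))

/-- The identity of the `n`-cube. -/
def id (n : ℕ) : CubeFace n n := ⟨Function.Embedding.refl _, fun _ => false⟩

/-- The composition `g ∘ f` of face embeddings. -/
def comp {l m n : ℕ} (g : CubeFace m n) (f : CubeFace l m) : CubeFace l n :=
  ⟨f.dir.trans g.dir, g.map f.base⟩

theorem map_id (n : ℕ) (x : Fin n → Bool) : (id n).map x = x := by
  funext j
  simp [map, id]

theorem map_comp {l m n : ℕ} (g : CubeFace m n) (f : CubeFace l m) (x : Fin l → Bool) :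
    (g.comp f).map x = g.map (f.map x) := by
  funext j
  by_cases hj : ∃ i, g.dir i = j
  · obtain ⟨i, rfl⟩ := hj
    simp only [map, comp, Function.Embedding.trans_apply, EmbeddingLike.apply_eq_iff_eq,
      exists_eq_left, Bool.decide_eq_true, Bool.xor_assoc]
  · have h : ∀ i, g.dir i ≠ j := fun i hi => hj ⟨i, hi⟩
    simp [map, comp, h]

/-- The vertex `b` of the `n`-cube. -/
def vertex {n : ℕ} (b : Fin n → Bool) : CubeFace 0 n :=
  ⟨⟨fun i => i.elim0, fun i => i.elim0⟩, b⟩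

/-- The edge of the `n`-cube that leaves the vertex `b` in the direction `i`, oriented away
from `b`. -/
def edge {n : ℕ} (b : Fin n → Bool) (i : Fin n) : CubeFace 1 n :=
  ⟨⟨fun _ => i, fun _ _ _ => Subsingleton.elim _ _⟩, b⟩

end CubeFace

/-- A cube complex, given by its parametrized cubes. An element of `cube n` is an `n`-cube of the
complex together with an identification of it with the standard `n`-cube, so that every `n`-cube is
represented by `2^n * n!` elements, on which the symmetries of the standard cube act freely
(distinct faces of one cube may be identified with each other, but the interior of a cube is
embedded). In particular `cube 0` is the set of vertices, and `cube 1` is the set of edges with a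
chosen direction. -/
structure CubeComplex where
  cube : ℕ → Type u
  /-- restriction of a parametrized cube to a face of the standard cube -/
  face : ∀ {m n : ℕ}, CubeFace m n → cube n → cube m
  face_id : ∀ (n : ℕ) (c : cube n), face (CubeFace.id n) c = c
  face_comp : ∀ {l m n : ℕ} (g : CubeFace m n) (f : CubeFace l m) (c : cube n),
    face (g.comp f) c = face f (face g c)
  free : ∀ (n : ℕ) (f : CubeFace n n) (c : cube n), face f c = c → f = CubeFace.id n

namespace CubeComplex

section

variable (X : CubeComplex.{u})

/-- The complex has finitely many cubes (in particular it has finite dimension). -/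
def IsFinite : Prop := Finite (Σ n, X.cube n)

variable {X}

/-- The vertex of a parametrized cube at the origin. -/
def origin {n : ℕ} (c : X.cube n) : X.cube 0 := X.face (CubeFace.vertex fun _ => false) c

/-- The edge of a parametrized cube that leaves its origin in the direction `i`. -/
def originEdge {n : ℕ} (c : X.cube n) (i : Fin n) : X.cube 1 :=
  X.face (CubeFace.edge (fun _ => false) i) c

/-- The initial vertex of an oriented edge. -/
def source (e : X.cube 1) : X.cube 0 := X.face (CubeFace.vertex fun _ => false) e

/-- The terminal vertex of an oriented edge. -/
def target (e : X.cube 1) : X.cube 0 := X.face (CubeFace.vertex fun _ => true) e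

/-- The same edge with the other direction. -/
def flip (e : X.cube 1) : X.cube 1 := X.face (CubeFace.edge (fun _ => true) 0) e

/-- The side of a square from `(0,0)` to `(1,0)`. -/
def bottom (s : X.cube 2) : X.cube 1 := X.face (CubeFace.edge ![false, false] 0) s

/-- The side of a square from `(0,1)` to `(1,1)`. -/
def top (s : X.cube 2) : X.cube 1 := X.face (CubeFace.edge ![false, true] 0) s

/-- The side of a square from `(0,0)` to `(0,1)`. -/
def left (s : X.cube 2) : X.cube 1 := X.face (CubeFace.edge ![false, false] 1) s

/-- The side of a square from `(1,0)` to `(1,1)`. -/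
def right (s : X.cube 2) : X.cube 1 := X.face (CubeFace.edge ![true, false] 1) s

/-- The oriented edges `e`, `e'` leave a common vertex and are consecutive edges of a square at that
vertex; that is, `e` and `e'` are adjacent in the link of their common source. -/
def FormCorner (e e' : X.cube 1) : Prop := ∃ s : X.cube 2, bottom s = e ∧ left s = e'

variable (X)

/-- Nonpositively curved complexes: the link of every vertex is a flag simplicial complex. The
vertices of the link of `v` are the oriented edges that leave `v` (a loop gives two of them), and a
parametrized `d`-cube with origin `v` is a `(d-1)`-simplex of the link with an ordering of its
vertices. -/
structure IsNPC : Prop where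
  /-- the vertices of a simplex of the link are distinct -/
  link_nondegenerate : ∀ s : X.cube 2, bottom s ≠ left s
  /-- a simplex of the link is determined by its vertices -/
  link_simplicial : ∀ (d : ℕ) (c c' : X.cube d), origin c = origin c' →
    (∀ i, originEdge c i = originEdge c' i) → c = c'
  /-- every clique of the link spans a simplex -/
  link_flag : ∀ (d : ℕ) (v : X.cube 0) (e : Fin d → X.cube 1), (∀ i, source (e i) = v) →
    (∀ i j, i ≠ j → FormCorner (e i) (e j)) →
      ∃ c : X.cube d, origin c = v ∧ ∀ i, originEdge c i = e i

/-! ### Hyperplanes and special complexes -/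

/-- Two oriented edges are parallel: the equivalence relation generated by being opposite sides of a
square with the same direction. -/
def OrientedParallel : X.cube 1 → X.cube 1 → Prop :=
  Relation.EqvGen fun e e' => ∃ s : X.cube 2, e = bottom s ∧ e' = top s

/-- The hyperplanes, that is, the classes of the parallelism relation on the unoriented edges. -/
def Hyperplane : Type u :=
  Quot fun e e' : X.cube 1 => e' = flip e ∨ ∃ s : X.cube 2, e = bottom s ∧ e' = top s

variable {X}

/-- The hyperplane dual to an edge. -/
def hyperplane (e : X.cube 1) : X.Hyperplane := Quot.mk _ e

namespace Hyperplane

/-- A hyperplane is two-sided if its dual edges can be directed consistently: transport along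
squares never reverses a dual edge. -/
def IsTwoSided (H : X.Hyperplane) : Prop :=
  ∀ e : X.cube 1, hyperplane e = H → ¬ X.OrientedParallel e (flip e)

/-- Two hyperplanes intersect if they are dual to consecutive edges of some square. -/
def Intersect (H₁ H₂ : X.Hyperplane) : Prop :=
  ∃ s : X.cube 2, hyperplane (bottom s) = H₁ ∧ hyperplane (left s) = H₂

/-- A hyperplane self-intersects if it is dual to two consecutive edges of some square. -/
def SelfIntersects (H : X.Hyperplane) : Prop := Intersect H H

/-- `H₁` and `H₂` are dual to distinct edges `e₁`, `e₂` with a common end vertex (the edges are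
directed away from it) that are not consecutive edges of a square at that vertex. -/
def Osculate (H₁ H₂ : X.Hyperplane) : Prop :=
  ∃ e₁ e₂ : X.cube 1, source e₁ = source e₂ ∧ e₁ ≠ e₂ ∧ e₂ ≠ flip e₁ ∧ ¬ FormCorner e₁ e₂ ∧
    hyperplane e₁ = H₁ ∧ hyperplane e₂ = H₂

/-- Direct self-osculation: `H` osculates with itself at two edges such that the common vertex is
the source of both or the sink of both, for a consistent direction of the edges dual to `H`. -/
def DirectlySelfOsculates (H : X.Hyperplane) : Prop :=
  ∃ e₁ e₂ : X.cube 1, source e₁ = source e₂ ∧ e₁ ≠ e₂ ∧ e₂ ≠ flip e₁ ∧ ¬ FormCorner e₁ e₂ ∧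
    hyperplane e₁ = H ∧ X.OrientedParallel e₁ e₂

end Hyperplane

variable (X)

/-- Special cube complexes. -/
structure IsSpecial : Prop where
  two_sided : ∀ H : X.Hyperplane, H.IsTwoSided
  not_selfIntersects : ∀ H : X.Hyperplane, ¬ H.SelfIntersects
  not_directlySelfOsculates : ∀ H : X.Hyperplane, ¬ H.DirectlySelfOsculates
  not_interOsculate : ∀ H₁ H₂ : X.Hyperplane, H₁ ≠ H₂ → ¬ (H₁.Intersect H₂ ∧ H₁.Osculate H₂)

/-! ### Simple connectedness -/

variable {X}

/-- The list of oriented edges is an edge path from `u` to `v` in the 1-skeleton. -/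
def IsPath : X.cube 0 → List (X.cube 1) → X.cube 0 → Prop
  | u, [], v => u = v
  | u, e :: l, v => source e = u ∧ IsPath (target e) l v

/-- Elementary homotopies: deleting a backtracking, or replacing two consecutive sides of a square
by the other two sides. -/
def ElemHomotopy (p q : List (X.cube 1)) : Prop :=
  (∃ l l' e, p = l ++ [e, flip e] ++ l' ∧ q = l ++ l') ∨
    ∃ l l' s, p = l ++ [bottom s, right s] ++ l' ∧ q = l ++ [left s, top s] ++ l'

/-- Homotopy of edge paths from `u` to `v`. -/
def Homotopic {u v : X.cube 0} :
    {p : List (X.cube 1) // IsPath u p v} → {p : List (X.cube 1) // IsPath u p v} → Prop :=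
  Relation.EqvGen fun p q => ElemHomotopy p.1 q.1

variable (X)

/-- The complex is connected, and every closed edge path is null-homotopic. -/
structure IsSimplyConnected : Prop where
  nonempty : Nonempty (X.cube 0)
  connected : ∀ u v : X.cube 0, ∃ p, IsPath u p v
  null_homotopic : ∀ (v : X.cube 0) (p : {p : List (X.cube 1) // IsPath v p v}),
    Homotopic p ⟨[], rfl⟩

end

/-! ### Coverings -/

/-- Maps of cube complexes that send `n`-cubes to `n`-cubes and preserve faces. -/
structure Hom (Y X : CubeComplex.{u}) where
  map : ∀ {n : ℕ}, Y.cube n → X.cube n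
  map_face : ∀ {m n : ℕ} (f : CubeFace m n) (c : Y.cube n), map (Y.face f c) = X.face f (map c)

/-- Covering maps: surjections that restrict to a bijection from the star of every vertex `y` (with
multiplicities: all parametrized cubes with origin `y`) onto the star of its image. -/
structure Hom.IsCovering {Y X : CubeComplex.{u}} (φ : Hom Y X) : Prop where
  surjective : ∀ (n : ℕ) (c : X.cube n), ∃ d : Y.cube n, φ.map d = c
  star_bijective : ∀ (n : ℕ) (y : Y.cube 0) (c : X.cube n), origin c = φ.map y →
    ∃! d : Y.cube n, origin d = y ∧ φ.map d = c

/-- Universal covers: simply connected covers. -/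
structure Hom.IsUniversalCover {Y X : CubeComplex.{u}} (φ : Hom Y X) : Prop where
  covering : φ.IsCovering
  simply_connected : Y.IsSimplyConnected

/-- Virtually special complexes: finite NPC complexes with a finite special NPC cover. -/
def IsVirtuallySpecial (X : CubeComplex.{u}) : Prop :=
  X.IsFinite ∧ X.IsNPC ∧ ∃ (Y : CubeComplex.{u}) (φ : Hom Y X),
    Y.IsFinite ∧ Y.IsNPC ∧ Y.IsSpecial ∧ φ.IsCovering

/-! ### Directed complexes -/

/-- An admissible orientation: every edge gets exactly one of its two directions (`pos e` says that
`e` has the chosen direction), and opposite sides of every square get the same direction. -/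
structure AdmissibleOrientation (X : CubeComplex.{u}) where
  pos : X.cube 1 → Prop
  pos_flip : ∀ e, pos (flip e) ↔ ¬ pos e
  pos_parallel : ∀ s : X.cube 2, pos (bottom s) ↔ pos (top s)

namespace AdmissibleOrientation

/-- The orientation of `Y` induced along `φ : Y → X`. -/
def lift {Y X : CubeComplex.{u}} (o : X.AdmissibleOrientation) (φ : Hom Y X) :
    Y.AdmissibleOrientation where
  pos e := o.pos (φ.map e)
  pos_flip e := by
    have h : φ.map (flip e) = flip (φ.map e) := φ.map_face _ e
    rw [h]; exact o.pos_flip _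
  pos_parallel s := by
    have h₁ : φ.map (bottom s) = bottom (φ.map s) := φ.map_face _ s
    have h₂ : φ.map (top s) = top (φ.map s) := φ.map_face _ s
    rw [h₁, h₂]; exact o.pos_parallel _

/-- `o.Reach x y`: there is a directed path from `x` to `y`. -/
def Reach {X : CubeComplex.{u}} (o : X.AdmissibleOrientation) : X.cube 0 → X.cube 0 → Prop :=
  Relation.ReflTransGen fun x y => ∃ e : X.cube 1, o.pos e ∧ source e = x ∧ target e = y

/-- The vertices of the principal filter of `v`. -/
abbrev Filter {X : CubeComplex.{u}} (o : X.AdmissibleOrientation) (v : X.cube 0) : Type u :=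
  {x : X.cube 0 // o.Reach v x}

end AdmissibleOrientation

end CubeComplex

/-! ### Strongly regular and cover-special event structures -/

namespace EventStructure

variable {E : Type u} [PartialOrder E] (S : EventStructure E)

/-- For some admissible orientation of `X`, lifted to the universal cover `X'` of `X`, the domain of
`S` is isomorphic, as a partially ordered set, to a principal filter of `X'`. -/
def DomainIsFilterOfUniversalCover (X : CubeComplex.{0}) : Prop :=
  ∃ (o : X.AdmissibleOrientation) (X' : CubeComplex.{0}) (φ : CubeComplex.Hom X' X)
    (v : X'.cube 0), φ.IsUniversalCover ∧
      Nonempty ((fun c c' : S.Domain => c ≤ c') ≃r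
        (fun x y : (o.lift φ).Filter v => (o.lift φ).Reach x.1 y.1))

/-- Strongly regular event structures. -/
def IsStronglyRegular : Prop :=
  ∃ X : CubeComplex.{0}, X.IsFinite ∧ X.IsNPC ∧ S.DomainIsFilterOfUniversalCover X

/-- Cover-special event structures. -/
def IsCoverSpecial : Prop :=
  S.IsStronglyRegular ∧
    ∃ X : CubeComplex.{0}, X.IsVirtuallySpecial ∧ S.DomainIsFilterOfUniversalCover X

end EventStructure

/-! The event structure is simulated by a finite asynchronous automaton, and the automaton yields a
special cube complex.

On the geometric side, consider signed partial injections of a set of states such that independent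
ones commute. An `n`-cube is a state together with `n` pairwise independent enabled signed letters.
An edge is determined by its source and its signed letter, two edges leaving a vertex span a square
exactly when their letters are independent, and letters are constant along hyperplanes. Hence the
complex is always NPC and special (`isNPC_complex`, `isSpecial_complex`), and no further cover is
needed. Its universal cover is a component of the product with the right-angled Artin group of the
independence relation, whose elements are represented by pilings. Words with equal piling differ by
exchanges of independent letters, and these exchanges are homotopies across squares
(`isSimplyConnected_of_piling`).

The automaton follows Zielonka's construction. The cell of a letter `b` stores finite information
about the least configuration containing the `b`-events so far: bounded time stamps of last events,
their order, and the effects of complements of views on sets of residual classes. Time stamps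
recognise whether two views have the same last event. Therefore the information about a union of
views is computable from the parts (`info_union`), and that about the causes of an event from its
past (`info_causes`). The effects determine the residual class of a configuration
(`future_eq_of_info_eq`). So if the cells dependent on a letter look as they do at the past of an
event with that letter, then such an event is enabled (`exists_enabled_of_info_eq`).

Consequently the positive steps from the state of a configuration are exactly its enabled events.
Sending a configuration to its cells and its piling identifies the domain with the principal filter
of the base point in the universal cover (`domainIsFilter`). -/

/-- A system of signed partial injections, indexed by `T × Bool`, of a set `V`, such that
independent partial injections commute in a strong sense. -/
structure IndependenceSystem (T : Type) where
  /-- the states -/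
  V : Type
  /-- the independence relation -/
  indep : T → T → Prop
  indep_irrefl : ∀ t, ¬ indep t t
  indep_symm : ∀ {t t'}, indep t t' → indep t' t
  /-- the signed partial injections -/
  step : V → T × Bool → V → Prop
  step_flip : ∀ {v d w}, step v d w → step w (d.1, !d.2) v
  step_det : ∀ {v d w w'}, step v d w → step v d w' → w = w'
  diamond : ∀ {v d d' w w'}, indep d.1 d'.1 → step v d w → step v d' w' →
    ∃ u, step w d' u ∧ step w' d u

/-! ### The special cube complex of a system of commuting partial injections -/

namespace IndependenceSystem

open CubeComplex

variable {T : Type} (M : IndependenceSystem T)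

/-- The direction `d`, reversed if `b` is true. -/
def turn (d : T × Bool) (b : Bool) : T × Bool := (d.1, xor d.2 b)

/-- The neighbour of a vertex of the standard cube in the direction `i`. -/
def flipAt {n : ℕ} (b : Fin n → Bool) (i : Fin n) : Fin n → Bool := Function.update b i (!b i)

theorem flipAt_flipAt {n : ℕ} (b : Fin n → Bool) (i : Fin n) : flipAt (flipAt b i) i = b := by
  simp [flipAt]

theorem flipAt_self {n : ℕ} (b : Fin n → Bool) (i : Fin n) : flipAt b i i = !b i := by
  simp [flipAt]

theorem turn_false (d : T × Bool) : turn d false = d := by simp [turn]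

theorem turn_turn (d : T × Bool) (a b : Bool) : turn (turn d a) b = turn d (xor a b) := by
  simp [turn]

/-- Parametrized cubes of the system. -/
@[ext]
structure Cube (n : ℕ) where
  vtx : (Fin n → Bool) → M.V
  dir : Fin n → T × Bool
  indep : ∀ i j, i ≠ j → M.indep (dir i).1 (dir j).1
  step : ∀ b i, M.step (vtx b) (turn (dir i) (b i)) (vtx (flipAt b i))

theorem _root_.CubeFace.map_flipAt {m n : ℕ} (f : CubeFace m n) (b : Fin m → Bool) (i : Fin m) :
    f.map (flipAt b i) = flipAt (f.map b) (f.dir i) := by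
  funext j
  by_cases hj : ∃ k, f.dir k = j
  · obtain ⟨k, rfl⟩ := hj
    by_cases hk : k = i
    · subst hk
      simp [CubeFace.map, flipAt]
    · simp [CubeFace.map, flipAt, Function.update_apply, hk]
  · have h : ∀ k, f.dir k ≠ j := fun k hk => hj ⟨k, hk⟩
    simp [CubeFace.map, flipAt, Function.update_apply, h, (h i).symm]

theorem _root_.CubeFace.map_dir {m n : ℕ} (f : CubeFace m n) (b : Fin m → Bool) (i : Fin m) :
    f.map b (f.dir i) = xor (f.base (f.dir i)) (b i) := by
  simp [CubeFace.map]

theorem _root_.CubeFace.map_zero {m n : ℕ} (f : CubeFace m n) :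
    f.map (fun _ => false) = f.base := by
  funext j
  simp [CubeFace.map]

variable {M}

/-- The face of a cube. -/
def Cube.face {m n : ℕ} (f : CubeFace m n) (c : M.Cube n) : M.Cube m where
  vtx b := c.vtx (f.map b)
  dir i := turn (c.dir (f.dir i)) (f.base (f.dir i))
  indep i j h := c.indep _ _ fun h' => h (f.dir.injective h')
  step b i := by
    have h := c.step (f.map b) (f.dir i)
    rwa [← f.map_flipAt, f.map_dir, ← turn_turn] at h

variable (M)

/-- The cube complex of a system. -/
def complex : CubeComplex.{0} where
  cube n := M.Cube n
  face f c := c.face f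
  face_id n c := by
    ext1
    · funext b
      simp [Cube.face, CubeFace.map_id]
    · funext i
      simp [Cube.face, CubeFace.id, turn]
  face_comp g f c := by
    ext1
    · funext b
      simp [Cube.face, CubeFace.map_comp]
    · funext i
      simp [Cube.face, CubeFace.comp, turn_turn, CubeFace.map_dir]
  free n f c h := by
    -- A symmetry fixing the cube preserves its signed directions. Distinct coordinates carry
    -- independent, hence distinct, letters, so no coordinate is moved; comparing signs then gives
    -- the trivial base.
    have h1 : ∀ i, turn (c.dir (f.dir i)) (f.base (f.dir i)) = c.dir i := fun i =>
      congrFun (congrArg Cube.dir h) i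
    have h2 : ∀ i, f.dir i = i := by
      intro i
      by_contra hi
      have := c.indep _ _ hi
      rw [← h1 i] at this
      exact M.indep_irrefl _ this
    ext i
    · simp [h2, CubeFace.id]
    · have := congrArg Prod.snd (h1 i)
      rw [h2] at this
      cases hb : f.base i <;> simp_all [turn, CubeFace.id]

variable {M}

/-- Steps are deterministic, so every vertex is forced by a walk from the origin. The induction is
on the number of coordinates that are true. -/
theorem Cube.ext_origin {n : ℕ} {c c' : M.Cube n}
    (h0 : c.vtx (fun _ => false) = c'.vtx (fun _ => false)) (hd : c.dir = c'.dir) : c = c' := by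
  ext1
  · funext b
    induction hk : (Finset.univ.filter fun i => b i = true).card generalizing b with
    | zero =>
      have : b = fun _ => false := by
        funext i
        have := (Finset.card_eq_zero.1 hk)
        rw [Finset.filter_eq_empty_iff] at this
        simpa using this (Finset.mem_univ i)
      rw [this, h0]
    | succ k ih =>
      obtain ⟨i, hi⟩ : ∃ i, b i = true := by
        have : (Finset.univ.filter fun i => b i = true).Nonempty := by
          rw [← Finset.card_pos]; omega
        obtain ⟨i, hi⟩ := this
        exact ⟨i, (Finset.mem_filter.1 hi).2⟩
      have hb : (Finset.univ.filter fun j => flipAt b i j = true) =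
          (Finset.univ.filter fun j => b j = true).erase i := by
        ext j
        rw [Finset.mem_filter, Finset.mem_erase, Finset.mem_filter]
        by_cases hj : j = i
        · subst hj; simp [flipAt, hi]
        · simp [flipAt, hj]
      have h1 := ih (flipAt b i) (by rw [hb, Finset.card_erase_of_mem (by simp [hi]), hk]; rfl)
      have s := c.step (flipAt b i) i
      have s' := c'.step (flipAt b i) i
      rw [flipAt_flipAt] at s s'
      rw [h1, hd] at s
      exact M.step_det s s'
  · exact hd

/-- The end of a signed step, if there is one. -/
noncomputable def next (v : M.V) (d : T × Bool) : M.V :=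
  open Classical in if h : ∃ w, M.step v d w then h.choose else v

theorem step_next {v : M.V} {d : T × Bool} (h : ∃ w, M.step v d w) : M.step v d (next v d) := by
  rw [next, dif_pos h]
  exact h.choose_spec

theorem enabled_next {v : M.V} {d d' : T × Bool} (hI : M.indep d.1 d'.1)
    (h : ∃ w, M.step v d w) (h' : ∃ w, M.step v d' w) : ∃ w, M.step (next v d) d' w := by
  obtain ⟨w', h'⟩ := h'
  obtain ⟨u, hu, -⟩ := M.diamond hI (step_next h) h'
  exact ⟨u, hu⟩

/-- Iterated diamonds form a ladder of squares between two parallel walks. Enabledness of the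
remaining letters is preserved along the way, so the fallback value of `next` never occurs. -/
theorem step_foldl_next (l : List (T × Bool)) {v w : M.V} {d : T × Bool} (hs : M.step v d w)
    (hd : ∀ d' ∈ l, M.indep d.1 d'.1) (hl : l.Pairwise fun d d' => M.indep d.1 d'.1)
    (he : ∀ d' ∈ l, ∃ w, M.step v d' w) : M.step (l.foldl next v) d (l.foldl next w) := by
  induction l generalizing v w with
  | nil => exact hs
  | cons d' l ih =>
    simp only [List.foldl_cons]
    simp only [List.mem_cons, forall_eq_or_imp, List.pairwise_cons] at hd hl he
    obtain ⟨u, h1, h2⟩ := M.diamond hd.1 hs (step_next he.1)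
    have h3 : u = next w d' := M.step_det h1 (step_next ⟨u, h1⟩)
    subst h3
    exact ih h2 hd.2 hl.2 fun d'' h => enabled_next (hl.1 _ h) he.1 (he.2 _ h)

theorem enabled_foldl_next (l : List (T × Bool)) {v : M.V} {d : T × Bool}
    (hs : ∃ w, M.step v d w)
    (hd : ∀ d' ∈ l, M.indep d.1 d'.1) (hl : l.Pairwise fun d d' => M.indep d.1 d'.1)
    (he : ∀ d' ∈ l, ∃ w, M.step v d' w) : ∃ w, M.step (l.foldl next v) d w := by
  obtain ⟨w, hw⟩ := hs
  exact ⟨_, step_foldl_next l hw hd hl he⟩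

theorem exists_cube {n : ℕ} (v : M.V) (d : Fin n → T × Bool)
    (hI : ∀ i j, i ≠ j → M.indep (d i).1 (d j).1) (he : ∀ i, ∃ w, M.step v (d i) w) :
    ∃ c : M.Cube n, c.vtx (fun _ => false) = v ∧ c.dir = d := by
  -- The vertex `b` is reached by firing the letters of its true coordinates in increasing order.
  -- Switching coordinate `i` on inserts one letter, and the resulting step is carried past the
  -- later letters by `step_foldl_next`.
  let X : (Fin n → Bool) → M.V := fun b =>
    (((List.finRange n).filter (fun i => b i)).map d).foldl next v
  have key : ∀ b i, b i = false → M.step (X b) (d i) (X (flipAt b i)) := by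
    intro b i hb
    obtain ⟨l₁, l₂, hl⟩ := List.append_of_mem (List.mem_finRange i)
    have hnd := List.nodup_finRange n
    rw [hl] at hnd
    have hi1 : i ∉ l₁ := fun h => by
      rw [List.nodup_append] at hnd
      exact hnd.2.2 i h i (by simp) rfl
    have hi2 : i ∉ l₂ := fun h => by simp [List.nodup_append, h] at hnd
    have f1 : l₁.filter (fun j => flipAt b i j) = l₁.filter fun j => b j :=
      List.filter_congr fun j hj => by simp [flipAt, ne_of_mem_of_not_mem hj hi1]
    have f2 : l₂.filter (fun j => flipAt b i j) = l₂.filter fun j => b j :=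
      List.filter_congr fun j hj => by simp [flipAt, ne_of_mem_of_not_mem hj hi2]
    have hpw : ((l₁ ++ l₂).map d).Pairwise fun d d' => M.indep d.1 d'.1 := by
      have : (l₁ ++ l₂).Nodup := hnd.sublist (by simp)
      rw [List.pairwise_map]
      exact this.imp fun h => hI _ _ h
    have hpw1 : (((l₁.filter fun j => b j)).map d).Pairwise fun d d' => M.indep d.1 d'.1 :=
      hpw.sublist ((List.filter_sublist.trans (List.sublist_append_left _ _)).map d)
    have hpw2 : (((l₂.filter fun j => b j)).map d).Pairwise fun d d' => M.indep d.1 d'.1 :=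
      hpw.sublist ((List.filter_sublist.trans (List.sublist_append_right _ _)).map d)
    have hen : ∀ l : List (Fin n), ∀ d' ∈ l.map d, ∃ w, M.step v d' w := by
      intro l d' h
      obtain ⟨j, -, rfl⟩ := List.mem_map.1 h
      exact he j
    have g1 : ∀ j ∉ l₁, ∀ d' ∈ (l₁.filter fun j => b j).map d, M.indep (d j).1 d'.1 := by
      intro j hj d' h
      obtain ⟨k, hk, rfl⟩ := List.mem_map.1 h
      exact hI _ _ fun e => hj (e ▸ (List.mem_filter.1 hk).1)
    have g2 : ∀ d' ∈ (l₂.filter fun j => b j).map d, M.indep (d i).1 d'.1 := by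
      intro d' h
      obtain ⟨k, hk, rfl⟩ := List.mem_map.1 h
      exact hI _ _ fun e => hi2 (e ▸ (List.mem_filter.1 hk).1)
    have hX : X b = ((l₂.filter fun j => b j).map d).foldl next
        (((l₁.filter fun j => b j).map d).foldl next v) := by
      simp [X, hl, List.filter_append, hb, List.foldl_append]
    have hX' : X (flipAt b i) = ((l₂.filter fun j => b j).map d).foldl next
        (next (((l₁.filter fun j => b j).map d).foldl next v) (d i)) := by
      simp only [X, hl, List.filter_append, List.filter_cons, f1, f2, flipAt_self, hb]
      simp [List.foldl_append]
    rw [hX, hX']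
    refine step_foldl_next _ (step_next (enabled_foldl_next _ (he i) (g1 i hi1) hpw1 (hen _)))
      g2 hpw2 ?_
    intro d' h
    obtain ⟨k, hk, rfl⟩ := List.mem_map.1 h
    have hk2 : k ∈ l₂ := (List.mem_filter.1 hk).1
    refine enabled_foldl_next _ (he k) (g1 k ?_) hpw1 (hen _)
    intro hk1
    rw [List.nodup_append] at hnd
    exact hnd.2.2 k hk1 k (by simp [hk2]) rfl
  refine ⟨⟨X, d, hI, fun b i => ?_⟩, ?_, rfl⟩
  · by_cases hb : b i = false
    · rw [hb, turn_false]
      exact key b i hb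
    · have hb' : b i = true := by simpa using hb
      have := M.step_flip (key (flipAt b i) i (by simp [flipAt_self, hb']))
      rw [flipAt_flipAt] at this
      simpa [turn, hb'] using this
  · simp [X]

/-! ### Vertices, edges and squares -/

/-- The state at a vertex. -/
def vtx₀ (v : M.complex.cube 0) : M.V := Cube.vtx (n := 0) v fun _ => false

theorem vtx₀_injective : Function.Injective (vtx₀ (M := M)) := fun _ _ h =>
  Cube.ext_origin h (funext fun i => i.elim0)

/-- The vertex of a state. -/
def vertex (v : M.V) : M.complex.cube 0 :=
  (⟨fun _ => v, fun i => i.elim0, fun i => i.elim0, fun _ i => i.elim0⟩ : M.Cube 0)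

@[simp] theorem vtx₀_vertex (v : M.V) : vtx₀ (M.vertex v) = v := rfl

@[simp] theorem vertex_vtx₀ (v : M.complex.cube 0) : M.vertex (vtx₀ v) = v :=
  vtx₀_injective rfl

/-- The signed label of an edge. -/
def lbl (e : M.complex.cube 1) : T × Bool := Cube.dir (n := 1) e 0

theorem vtx₀_origin {n : ℕ} (c : M.complex.cube n) :
    vtx₀ (origin c) = Cube.vtx (n := n) c fun _ => false := by
  change Cube.vtx c _ = _
  rw [CubeFace.map_zero]; rfl

theorem lbl_originEdge {n : ℕ} (c : M.complex.cube n) (i : Fin n) :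
    lbl (originEdge c i) = Cube.dir (n := n) c i := by
  change turn _ _ = _
  exact turn_false _

theorem vtx₀_source (e : M.complex.cube 1) :
    vtx₀ (source e) = Cube.vtx (n := 1) e fun _ => false := vtx₀_origin e

theorem vtx₀_target (e : M.complex.cube 1) :
    vtx₀ (target e) = Cube.vtx (n := 1) e fun _ => true := by
  change Cube.vtx e _ = _
  rw [CubeFace.map_zero]; rfl

theorem source_originEdge {n : ℕ} (c : M.complex.cube n) (i : Fin n) :
    source (originEdge c i) = origin c := by
  apply vtx₀_injective
  rw [vtx₀_source, vtx₀_origin]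
  change Cube.vtx c _ = _
  rw [CubeFace.map_zero]; rfl

theorem step_edge (e : M.complex.cube 1) :
    M.step (vtx₀ (source e)) (lbl e) (vtx₀ (target e)) := by
  rw [vtx₀_source, vtx₀_target]
  have := Cube.step (n := 1) e (fun _ => false) 0
  rw [turn_false] at this
  have h : (flipAt (fun _ => false) 0 : Fin 1 → Bool) = fun _ => true := by
    funext i
    rw [Subsingleton.elim i 0, flipAt_self]; rfl
  rwa [h] at this

theorem edge_ext {e e' : M.complex.cube 1} (h : vtx₀ (source e) = vtx₀ (source e'))
    (hl : lbl e = lbl e') : e = e' := by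
  rw [vtx₀_source, vtx₀_source] at h
  exact Cube.ext_origin h (funext fun i => by rw [Subsingleton.elim i 0]; exact hl)

theorem exists_complex_cube {n : ℕ} (v : M.V) (d : Fin n → T × Bool)
    (hI : ∀ i j, i ≠ j → M.indep (d i).1 (d j).1) (he : ∀ i, ∃ w, M.step v (d i) w) :
    ∃ c : M.complex.cube n, vtx₀ (origin c) = v ∧ ∀ i, lbl (originEdge c i) = d i := by
  obtain ⟨c, h1, h2⟩ := exists_cube v d hI he
  exact ⟨c, (vtx₀_origin _).trans h1, fun i => (lbl_originEdge _ i).trans (congrFun h2 i)⟩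

theorem complex_cube_ext {n : ℕ} {c c' : M.complex.cube n} (h0 : vtx₀ (origin c) = vtx₀ (origin c'))
    (hd : ∀ i, lbl (originEdge c i) = lbl (originEdge c' i)) : c = c' := by
  rw [vtx₀_origin, vtx₀_origin] at h0
  refine Cube.ext_origin h0 (funext fun i => ?_)
  rw [← lbl_originEdge, ← lbl_originEdge, hd]

theorem exists_edge {v w : M.V} {d : T × Bool} (h : M.step v d w) :
    ∃ e : M.complex.cube 1, vtx₀ (source e) = v ∧ lbl e = d ∧ vtx₀ (target e) = w := by
  obtain ⟨c, h1, h2⟩ := exists_complex_cube (n := 1) v (fun _ => d)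
    (fun i j h => absurd (Subsingleton.elim i j) h) (fun _ => ⟨w, h⟩)
  have h3 : lbl c = d := (lbl_originEdge c 0).symm.trans (h2 0)
  have h4 : vtx₀ (source c) = v := h1
  have := step_edge c
  rw [h3, h4] at this
  exact ⟨c, h4, h3, M.step_det this h⟩

theorem lbl_flip (e : M.complex.cube 1) : lbl (flip e) = turn (lbl e) true := rfl

theorem vtx₀_source_flip (e : M.complex.cube 1) : vtx₀ (source (flip e)) = vtx₀ (target e) := by
  rw [vtx₀_source, vtx₀_target]
  change Cube.vtx e _ = _
  rw [CubeFace.map_zero]; rfl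

theorem vtx₀_target_flip (e : M.complex.cube 1) : vtx₀ (target (flip e)) = vtx₀ (source e) := by
  have h := M.step_flip (step_edge e)
  have h' := step_edge (flip e)
  rw [vtx₀_source_flip, lbl_flip] at h'
  have : turn (lbl e) true = ((lbl e).1, !(lbl e).2) := by simp [turn]
  rw [this] at h'
  exact M.step_det h' h

theorem lbl_bottom (s : M.complex.cube 2) : lbl (bottom s) = Cube.dir (n := 2) s 0 := turn_false _
theorem lbl_top (s : M.complex.cube 2) : lbl (top s) = Cube.dir (n := 2) s 0 := turn_false _
theorem lbl_left (s : M.complex.cube 2) : lbl (left s) = Cube.dir (n := 2) s 1 := turn_false _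
theorem lbl_right (s : M.complex.cube 2) : lbl (right s) = Cube.dir (n := 2) s 1 := turn_false _

theorem vtx₀_source_bottom (s : M.complex.cube 2) :
    vtx₀ (source (bottom s)) = Cube.vtx (n := 2) s ![false, false] := by
  rw [vtx₀_source]; change Cube.vtx s _ = _; rw [CubeFace.map_zero]; rfl
theorem vtx₀_source_top (s : M.complex.cube 2) :
    vtx₀ (source (top s)) = Cube.vtx (n := 2) s ![false, true] := by
  rw [vtx₀_source]; change Cube.vtx s _ = _; rw [CubeFace.map_zero]; rfl
theorem vtx₀_source_left (s : M.complex.cube 2) :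
    vtx₀ (source (left s)) = Cube.vtx (n := 2) s ![false, false] := by
  rw [vtx₀_source]; change Cube.vtx s _ = _; rw [CubeFace.map_zero]; rfl
theorem vtx₀_source_right (s : M.complex.cube 2) :
    vtx₀ (source (right s)) = Cube.vtx (n := 2) s ![true, false] := by
  rw [vtx₀_source]; change Cube.vtx s _ = _; rw [CubeFace.map_zero]; rfl

theorem vtx₀_target_bottom (s : M.complex.cube 2) :
    vtx₀ (target (bottom s)) = Cube.vtx (n := 2) s ![true, false] := by
  rw [vtx₀_target]; change Cube.vtx s _ = _; congr 1; funext i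
  fin_cases i <;> simp [CubeFace.map, CubeFace.edge, DFunLike.coe]
theorem vtx₀_target_left (s : M.complex.cube 2) :
    vtx₀ (target (left s)) = Cube.vtx (n := 2) s ![false, true] := by
  rw [vtx₀_target]; change Cube.vtx s _ = _; congr 1; funext i
  fin_cases i <;> simp [CubeFace.map, CubeFace.edge, DFunLike.coe]
theorem vtx₀_target_right (s : M.complex.cube 2) :
    vtx₀ (target (right s)) = Cube.vtx (n := 2) s ![true, true] := by
  rw [vtx₀_target]; change Cube.vtx s _ = _; congr 1; funext i
  fin_cases i <;> simp [CubeFace.map, CubeFace.edge, DFunLike.coe]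
theorem vtx₀_target_top (s : M.complex.cube 2) :
    vtx₀ (target (top s)) = Cube.vtx (n := 2) s ![true, true] := by
  rw [vtx₀_target]; change Cube.vtx s _ = _; congr 1; funext i
  fin_cases i <;> simp [CubeFace.map, CubeFace.edge, DFunLike.coe]

theorem indep_square (s : M.complex.cube 2) : M.indep (lbl (bottom s)).1 (lbl (left s)).1 := by
  rw [lbl_bottom, lbl_left]
  exact Cube.indep (n := 2) s 0 1 (by decide)

/-- Together with `indep_of_formCorner`, this makes adjacency in a link a property of the labels
alone; curvature and specialness both rest on it. -/
theorem formCorner_of_indep {e e' : M.complex.cube 1} (h : vtx₀ (source e) = vtx₀ (source e'))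
    (hI : M.indep (lbl e).1 (lbl e').1) : FormCorner e e' := by
  obtain ⟨c, h1, h2⟩ := exists_complex_cube (n := 2) (vtx₀ (source e)) ![lbl e, lbl e']
    (by
      intro i j hij
      fin_cases i <;> fin_cases j
      · exact absurd rfl hij
      · exact hI
      · exact M.indep_symm hI
      · exact absurd rfl hij)
    (by
      intro i
      fin_cases i
      · exact ⟨_, step_edge e⟩
      · exact ⟨_, h ▸ step_edge e'⟩)
  have h0 : (![false, false] : Fin 2 → Bool) = fun _ => false := by
    funext i; fin_cases i <;> rfl
  rw [vtx₀_origin] at h1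
  refine ⟨c, edge_ext ?_ ?_, edge_ext ?_ ?_⟩
  · rw [vtx₀_source_bottom, h0, h1]
  · rw [lbl_bottom, ← lbl_originEdge, h2]; rfl
  · rw [vtx₀_source_left, h0, h1, h]
  · rw [lbl_left, ← lbl_originEdge, h2]; rfl

theorem indep_of_formCorner {e e' : M.complex.cube 1} (h : FormCorner e e') :
    M.indep (lbl e).1 (lbl e').1 := by
  obtain ⟨s, rfl, rfl⟩ := h
  exact indep_square s

/-! ### Nonpositive curvature and specialness -/

variable (M)

/-- The simplices of a link are the sets of pairwise independent enabled letters, so every link is a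
clique complex. -/
theorem isNPC_complex : M.complex.IsNPC where
  link_nondegenerate s h := by
    have := indep_square s
    rw [h] at this
    exact M.indep_irrefl _ this
  link_simplicial d c c' h0 he := complex_cube_ext (by rw [h0]) fun i => by rw [he]
  link_flag d v e hv hc := by
    obtain ⟨c, h1, h2⟩ := exists_complex_cube (n := d) (vtx₀ v) (fun i => lbl (e i))
      (fun i j h => indep_of_formCorner (hc i j h))
      (fun i => ⟨vtx₀ (target (e i)), hv i ▸ step_edge (e i)⟩)
    have h3 : origin c = v := vtx₀_injective h1
    refine ⟨c, h3, fun i => edge_ext ?_ (h2 i)⟩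
    rw [source_originEdge, h3, hv]

variable {M}

theorem lbl_eq_of_orientedParallel {e e' : M.complex.cube 1}
    (h : M.complex.OrientedParallel e e') : lbl e = lbl e' := by
  induction h with
  | rel x y h => obtain ⟨s, rfl, rfl⟩ := h; rw [lbl_bottom, lbl_top]
  | refl x => rfl
  | symm x y _ ih => exact ih.symm
  | trans x y z _ _ ih ih' => exact ih.trans ih'

/-- The label of a hyperplane. -/
def hyperplaneLabel : M.complex.Hyperplane → T :=
  Quot.lift (fun e => (lbl e).1) (by
    rintro e e' (rfl | ⟨s, rfl, rfl⟩)
    · rfl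
    · rw [lbl_bottom, lbl_top])

variable (M)

/-- The signed label is invariant under oriented parallelism, and its letter is a hyperplane
invariant. Each pathology would thus give a label equal to its reverse, a letter independent of
itself, two distinct edges with the same source and signed label, or independent edges at a vertex
that span no square. -/
theorem isSpecial_complex : M.complex.IsSpecial where
  two_sided H e _ h := by
    have := congrArg Prod.snd (lbl_eq_of_orientedParallel h)
    simp [lbl_flip, turn] at this
  not_selfIntersects H := by
    rintro ⟨s, h, h'⟩
    have h1 := indep_square s
    have h2 : (lbl (bottom s)).1 = (lbl (left s)).1 := congrArg hyperplaneLabel (h.trans h'.symm)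
    rw [h2] at h1
    exact M.indep_irrefl _ h1
  not_directlySelfOsculates H := by
    rintro ⟨e₁, e₂, hs, hne, -, -, -, hp⟩
    exact hne (edge_ext (by rw [hs]) (lbl_eq_of_orientedParallel hp))
  not_interOsculate H₁ H₂ _ := by
    rintro ⟨⟨s, h1, h2⟩, e₁, e₂, hs, -, -, hc, h3, h4⟩
    refine hc (formCorner_of_indep (by rw [hs]) ?_)
    have h5 : (lbl (bottom s)).1 = (lbl e₁).1 := congrArg hyperplaneLabel (h1.trans h3.symm)
    have h6 : (lbl (left s)).1 = (lbl e₂).1 := congrArg hyperplaneLabel (h2.trans h4.symm)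
    rw [← h5, ← h6]
    exact indep_square s

/-- The directions of a cube have pairwise distinct letters, so the dimension is at most `Nat.card
T`. -/
theorem isFinite_complex [Finite T] [Finite M.V] : M.complex.IsFinite := by
  have hf : ∀ n, Finite (M.Cube n) := fun n =>
    Finite.of_injective (fun c : M.Cube n => (c.vtx, c.dir)) fun c c' h =>
      Cube.ext (congrArg Prod.fst h) (congrArg Prod.snd h)
  have hn : ∀ n, M.Cube n → n ≤ Nat.card T := by
    intro n c
    have := Nat.card_le_card_of_injective (fun i : Fin n => (c.dir i).1) (by
      intro i j h
      by_contra hij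
      have h' := c.indep i j hij
      simp only at h
      rw [h] at h'
      exact M.indep_irrefl _ h')
    simpa using this
  refine Finite.of_injective (β := Σ k : Fin (Nat.card T + 1), M.Cube k)
    (fun c => ⟨⟨c.1, Nat.lt_succ_of_le (hn c.1 c.2)⟩, c.2⟩) ?_
  rintro ⟨n, c⟩ ⟨n', c'⟩ h
  have h1 : n = n' := congrArg (fun x => (x.1 : ℕ)) h
  subst h1
  exact congrArg _ (eq_of_heq (Sigma.mk.inj_iff.1 h).2)

/-- The orientation of the edges by the signs of their labels. -/
def orientation : M.complex.AdmissibleOrientation where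
  pos e := (lbl e).2 = true
  pos_flip e := by rw [lbl_flip]; simp [turn]
  pos_parallel s := by rw [lbl_bottom, lbl_top]

/-! ### Coverings and components -/

variable {M} {M' : IndependenceSystem T}

/-- The map of complexes induced by a map of states that respects steps. -/
def homOfStep (p : M'.V → M.V) (hI : M'.indep = M.indep)
    (hp : ∀ {v d w}, M'.step v d w → M.step (p v) d (p w)) : Hom M'.complex M.complex where
  map {n} c := (⟨fun b => p (Cube.vtx (n := n) c b), Cube.dir (n := n) c,
    hI ▸ Cube.indep (n := n) c, fun b i => hp (Cube.step (n := n) c b i)⟩ : M.Cube n)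
  map_face _ _ := rfl

/-- A cube with prescribed origin amounts to a family of pairwise independent enabled letters, so
bijectivity on stars reduces to lifting single steps. -/
theorem isCovering_homOfStep (p : M'.V → M.V) (hI : M'.indep = M.indep)
    (hp : ∀ {v d w}, M'.step v d w → M.step (p v) d (p w)) (hsurj : Function.Surjective p)
    (hlift : ∀ {v d w}, M.step (p v) d w → ∃ w', M'.step v d w') :
    (homOfStep p hI hp).IsCovering := by
  have star : ∀ (n : ℕ) (y : M'.complex.cube 0) (c : M.complex.cube n),
      origin c = (homOfStep p hI hp).map y →
        ∃! d : M'.complex.cube n, origin d = y ∧ (homOfStep p hI hp).map d = c := by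
    intro n y c h
    have hc0 : Cube.vtx (n := n) c (fun _ => false) = p (vtx₀ y) := by
      rw [← vtx₀_origin, h]; rfl
    obtain ⟨d, h1, h2⟩ := exists_cube (M := M') (n := n) (vtx₀ y) (Cube.dir (n := n) c)
      (hI ▸ Cube.indep (n := n) c) (fun i => by
        have := Cube.step (n := n) c (fun _ => false) i
        rw [turn_false, hc0] at this
        exact hlift this)
    refine ⟨d, ⟨vtx₀_injective ((vtx₀_origin _).trans h1), ?_⟩, ?_⟩
    · exact Cube.ext_origin ((congrArg p h1).trans hc0.symm) h2
    · rintro d' ⟨h3, h4⟩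
      refine Cube.ext_origin ?_ ?_
      · rw [← vtx₀_origin, h3, h1]
      · rw [h2, ← h4]; rfl
  refine ⟨fun n c => ?_, star⟩
  obtain ⟨v, hv⟩ := hsurj (vtx₀ (origin c))
  obtain ⟨d, ⟨-, h⟩, -⟩ := star n (vertex v) c (vtx₀_injective hv.symm)
  exact ⟨d, h⟩

variable (M)

/-- The existence of a sequence of steps. -/
def Connected : M.V → M.V → Prop := Relation.ReflTransGen fun v w => ∃ d, M.step v d w

/-- The component of a state. -/
def component (v₀ : M.V) : IndependenceSystem T where
  V := {v : M.V // M.Connected v₀ v}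
  indep := M.indep
  indep_irrefl := M.indep_irrefl
  indep_symm := M.indep_symm
  step v d w := M.step v.1 d w.1
  step_flip h := M.step_flip h
  step_det h h' := Subtype.ext (M.step_det h h')
  diamond {v d d' w w'} hI h h' := by
    obtain ⟨u, h1, h2⟩ := M.diamond hI h h'
    exact ⟨⟨u, w.2.tail ⟨_, h1⟩⟩, h1, h2⟩

end IndependenceSystem

/-! ### Homotopy of edge paths -/

namespace CubeComplex

variable {X : CubeComplex.{u}}

theorem isPath_append {u w : X.cube 0} {p q : List (X.cube 1)} :
    IsPath u (p ++ q) w ↔ ∃ v, IsPath u p v ∧ IsPath v q w := by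
  induction p generalizing u with
  | nil => simp [IsPath]
  | cons e p ih => simp [IsPath, ih, and_assoc]

/-- Homotopic edge paths from `u` to `v`. -/
def PathHomotopic (u v : X.cube 0) (p q : List (X.cube 1)) : Prop :=
  ∃ (hp : IsPath u p v) (hq : IsPath u q v), Homotopic ⟨p, hp⟩ ⟨q, hq⟩

namespace PathHomotopic

variable {u v w : X.cube 0} {p q r : List (X.cube 1)}

theorem refl (h : IsPath u p v) : PathHomotopic u v p p := ⟨h, h, .refl _⟩

theorem symm (h : PathHomotopic u v p q) : PathHomotopic u v q p := by
  obtain ⟨h1, h2, h⟩ := h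
  exact ⟨h2, h1, .symm _ _ h⟩

theorem trans (h : PathHomotopic u v p q) (h' : PathHomotopic u v q r) :
    PathHomotopic u v p r := by
  obtain ⟨h1, h2, h⟩ := h
  obtain ⟨h3, h4, h'⟩ := h'
  exact ⟨h1, h4, .trans _ _ _ h h'⟩

theorem of_elem (hp : IsPath u p v) (hq : IsPath u q v) (h : ElemHomotopy p q) :
    PathHomotopic u v p q := ⟨hp, hq, .rel _ _ h⟩

end PathHomotopic

theorem ElemHomotopy.append {p q : List (X.cube 1)} (h : ElemHomotopy p q)
    (l l' : List (X.cube 1)) :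
    ElemHomotopy (l ++ p ++ l') (l ++ q ++ l') := by
  rcases h with ⟨m, m', e, rfl, rfl⟩ | ⟨m, m', s, rfl, rfl⟩
  · exact .inl ⟨l ++ m, m' ++ l', e, by simp, by simp⟩
  · exact .inr ⟨l ++ m, m' ++ l', s, by simp, by simp⟩

theorem PathHomotopic.append {u v w z : X.cube 0} {p q l l' : List (X.cube 1)}
    (h : PathHomotopic v w p q) (hl : IsPath u l v) (hl' : IsPath w l' z) :
    PathHomotopic u z (l ++ p ++ l') (l ++ q ++ l') := by
  have hh : ∀ {p}, IsPath v p w → IsPath u (l ++ p ++ l') z := fun hp =>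
    isPath_append.2 ⟨w, isPath_append.2 ⟨v, hl, hp⟩, hl'⟩
  obtain ⟨hp, hq, h⟩ := h
  suffices H : ∀ a b : {p : List (X.cube 1) // IsPath v p w}, Homotopic a b →
      PathHomotopic u z (l ++ a.1 ++ l') (l ++ b.1 ++ l') from H _ _ h
  intro a b hab
  induction hab with
  | rel a b h => exact .of_elem (hh a.2) (hh b.2) (h.append l l')
  | refl a => exact .refl (hh a.2)
  | symm a b _ ih => exact ih.symm
  | trans a b c _ _ ih ih' => exact ih.trans ih'

end CubeComplex

/-! ### Words up to commutation, pilings and the universal cover -/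

namespace IndependenceSystem

open CubeComplex

variable {T : Type} {M : IndependenceSystem T}

/-! ### Edge paths and words -/

theorem source_flip (e : M.complex.cube 1) : source (flip e) = target e :=
  vtx₀_injective (vtx₀_source_flip e)

theorem target_flip (e : M.complex.cube 1) : target (flip e) = source e :=
  vtx₀_injective (vtx₀_target_flip e)

theorem isPath_reverse {u v : M.complex.cube 0} {p : List (M.complex.cube 1)} (h : IsPath u p v) :
    IsPath v (p.map flip).reverse u := by
  induction p generalizing u with
  | nil => exact h.symm
  | cons e p ih =>
    obtain ⟨rfl, h⟩ := h
    rw [List.map_cons, List.reverse_cons, isPath_append]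
    exact ⟨_, ih h, source_flip e, target_flip e⟩

theorem flip_flip (e : M.complex.cube 1) : flip (flip e) = e := by
  refine edge_ext ?_ ?_
  · rw [source_flip, target_flip]
  · simp [lbl_flip, turn]

theorem reverse_append_homotopic {u v : M.complex.cube 0} {p : List (M.complex.cube 1)}
    (h : IsPath u p v) : PathHomotopic v v ((p.map flip).reverse ++ p) [] := by
  induction p generalizing u with
  | nil => exact .refl rfl
  | cons e p ih =>
    obtain ⟨rfl, h⟩ := h
    have hr := isPath_reverse h
    refine .trans (.of_elem ?_ ?_ (.inl ⟨(p.map flip).reverse, p, flip e, ?_, rfl⟩)) (ih h)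
    · exact isPath_append.2 ⟨_, isPath_reverse (p := e :: p) ⟨rfl, h⟩, rfl, h⟩
    · exact isPath_append.2 ⟨_, hr, h⟩
    · simp [flip_flip]

theorem path_ext {u v v' : M.complex.cube 0} {p p' : List (M.complex.cube 1)} (h : IsPath u p v)
    (h' : IsPath u p' v') (hl : p.map lbl = p'.map lbl) : p = p' := by
  induction p generalizing u p' with
  | nil => simpa using hl.symm
  | cons e p ih =>
    cases p' with
    | nil => simp at hl
    | cons e' p' =>
      simp only [List.map_cons, List.cons.injEq] at hl
      obtain ⟨rfl, h⟩ := h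
      obtain ⟨h1, h'⟩ := h'
      obtain rfl : e = e' := edge_ext (by rw [h1]) hl.1
      rw [ih h h' hl.2]

variable (M) in
/-- Exchanging two consecutive independent letters of a word. -/
def Swap (w w' : List (T × Bool)) : Prop :=
  ∃ u z d d', M.indep d.1 d'.1 ∧ w = u ++ [d, d'] ++ z ∧ w' = u ++ [d', d] ++ z

variable (M) in
/-- Words that agree up to exchanging independent letters. -/
def SwapEq : List (T × Bool) → List (T × Bool) → Prop := Relation.ReflTransGen M.Swap

theorem Swap.append {w w' : List (T × Bool)} (h : M.Swap w w') (l : List (T × Bool)) :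
    M.Swap (w ++ l) (w' ++ l) := by
  obtain ⟨u, z, d, d', hI, rfl, rfl⟩ := h
  exact ⟨u, z ++ l, d, d', hI, by simp, by simp⟩

theorem SwapEq.append {w w' : List (T × Bool)} (h : M.SwapEq w w') (l : List (T × Bool)) :
    M.SwapEq (w ++ l) (w' ++ l) :=
  Relation.ReflTransGen.lift (p := M.Swap) (· ++ l) (fun _ _ h' => Swap.append h' l) _ _ h

theorem homotopic_of_swap {u v : M.complex.cube 0} {p : List (M.complex.cube 1)}
    {w' : List (T × Bool)} (hp : IsPath u p v) (h : M.Swap (p.map lbl) w') :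
    ∃ p', p'.map lbl = w' ∧ PathHomotopic u v p p' := by
  obtain ⟨w₁, w₂, d, d', hI, hw, rfl⟩ := h
  obtain ⟨p₁, p₂, rfl, h12, rfl⟩ := List.map_eq_append_iff.1 hw
  obtain ⟨p₁, p₃, rfl, rfl, h3⟩ := List.map_eq_append_iff.1 h12
  obtain ⟨e, p₄, rfl, rfl, h4⟩ := List.map_eq_cons_iff.1 h3
  obtain ⟨e', p₅, rfl, rfl, h5⟩ := List.map_eq_cons_iff.1 h4
  obtain rfl := List.map_eq_nil_iff.1 h5
  obtain ⟨v₂, h12, hp2⟩ := isPath_append.1 hp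
  obtain ⟨v₁, hp1, he, he', h2⟩ := isPath_append.1 h12
  have h2 : target e' = v₂ := h2
  have s := step_edge e
  have s' := step_edge e'
  rw [he'] at s'
  -- At the middle vertex the reverse of `e` and the edge `e'` are both enabled and independent.
  -- Their diamond shows that the letter of `e'` is already enabled at the source of `e`, which
  -- provides the square.
  obtain ⟨y, hy, -⟩ := M.diamond (d := ((lbl e).1, !(lbl e).2)) hI (M.step_flip s) s'
  obtain ⟨sq, hs, hsl⟩ := exists_complex_cube (n := 2) (vtx₀ (source e)) ![lbl e, lbl e']
    (by
      intro i j hij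
      fin_cases i <;> fin_cases j
      · exact absurd rfl hij
      · exact hI
      · exact M.indep_symm hI
      · exact absurd rfl hij)
    (by
      intro i
      fin_cases i
      · exact ⟨_, s⟩
      · exact ⟨y, hy⟩)
  have h0 : (![false, false] : Fin 2 → Bool) = fun _ => false := by
    funext i; fin_cases i <;> rfl
  rw [vtx₀_origin] at hs
  have hb : bottom sq = e := edge_ext (by rw [vtx₀_source_bottom, h0, hs])
    (by rw [lbl_bottom, ← lbl_originEdge, hsl]; rfl)
  have hr : right sq = e' := edge_ext
    (by rw [vtx₀_source_right, ← vtx₀_target_bottom, hb, he'])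
    (by rw [lbl_right, ← lbl_originEdge, hsl]; rfl)
  have hl : lbl (left sq) = lbl e' := by rw [lbl_left, ← lbl_originEdge, hsl]; rfl
  have ht : lbl (top sq) = lbl e := by rw [lbl_top, ← lbl_originEdge, hsl]; rfl
  refine ⟨p₁ ++ [left sq, top sq] ++ p₂, by simp [hl, ht],
    .of_elem hp ?_ (.inr ⟨p₁, p₂, sq, ?_, rfl⟩)⟩
  · refine isPath_append.2 ⟨v₂, isPath_append.2 ⟨v₁, hp1, ?_, ?_, ?_⟩, hp2⟩
    · rw [← he, ← hb]
      apply vtx₀_injective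
      rw [vtx₀_source_left, vtx₀_source_bottom]
    · apply vtx₀_injective
      rw [vtx₀_source_top, vtx₀_target_left]
    · change target (top sq) = v₂
      rw [← h2, ← hr]
      apply vtx₀_injective
      rw [vtx₀_target_top, vtx₀_target_right]
  · rw [hb, hr]

theorem homotopic_of_swapEq {u v : M.complex.cube 0} {p : List (M.complex.cube 1)}
    {w' : List (T × Bool)} (hp : IsPath u p v) (h : M.SwapEq (p.map lbl) w') :
    ∃ p', p'.map lbl = w' ∧ PathHomotopic u v p p' := by
  induction h with
  | refl => exact ⟨p, rfl, .refl hp⟩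
  | tail _ h ih =>
    obtain ⟨p', rfl, hp'⟩ := ih
    obtain ⟨p'', h1, h2⟩ := homotopic_of_swap hp'.2.1 h
    exact ⟨p'', h1, hp'.trans h2⟩

theorem homotopic_of_swapEq' {u v : M.complex.cube 0} {p p' : List (M.complex.cube 1)}
    (hp : IsPath u p v) (hp' : IsPath u p' v) (h : M.SwapEq (p.map lbl) (p'.map lbl)) :
    PathHomotopic u v p p' := by
  obtain ⟨q, h1, h2⟩ := homotopic_of_swapEq hp h
  rwa [path_ext h2.2.1 hp' h1] at h2

/-! ### Pilings -/

variable (M)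

open Classical in
/-- Put the signed letter `d` on its own stack and a marker on the stacks of the other letters that
are dependent on it. -/
noncomputable def push (d : T × Bool) (r : T → List (Option Bool)) : T → List (Option Bool) :=
  fun t => if t = d.1 then some d.2 :: r t else if M.indep d.1 t then r t else none :: r t

open Classical in
/-- Remove the top of the stacks of all letters that are dependent on `t`. -/
noncomputable def pop (t : T) (r : T → List (Option Bool)) : T → List (Option Bool) :=
  fun t' => if M.indep t t' then r t' else (r t').tail

open Classical in
/-- Multiplication by a signed letter: cancel it if possible. -/
noncomputable def act (d : T × Bool) (r : T → List (Option Bool)) : T → List (Option Bool) :=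
  if (r d.1).head? = some (some (!d.2)) then M.pop d.1 r else M.push d r

/-- The piling of a word. -/
noncomputable def pile (w : List (T × Bool)) : T → List (Option Bool) :=
  w.foldl (fun r d => M.push d r) fun _ => []

/-- The pilings of reduced words. -/
def ValidPiling (r : T → List (Option Bool)) : Prop :=
  (∃ w, M.pile w = r) ∧
    ∀ t, (r t).IsChain fun x y => ∀ ε, x = some ε → y ≠ some !ε

variable {M}

theorem pile_append_singleton (w : List (T × Bool)) (d : T × Bool) :
    M.pile (w ++ [d]) = M.push d (M.pile w) := by
  simp [pile]

theorem push_self (d : T × Bool) (r : T → List (Option Bool)) :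
    M.push d r d.1 = some d.2 :: r d.1 := by
  simp [push]

theorem ne_of_indep {t t' : T} (h : M.indep t t') : t' ≠ t := by
  rintro rfl
  exact M.indep_irrefl _ h

theorem push_of_indep {d : T × Bool} {t : T} (h : M.indep d.1 t) (r : T → List (Option Bool)) :
    M.push d r t = r t := by
  simp [push, h, ne_of_indep h]

theorem pop_of_indep {t t' : T} (h : M.indep t t') (r : T → List (Option Bool)) :
    M.pop t r t' = r t' := by
  simp [pop, h]

theorem pop_push {d : T × Bool} (r : T → List (Option Bool)) : M.pop d.1 (M.push d r) = r := by
  funext t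
  by_cases h : M.indep d.1 t
  · rw [pop_of_indep h, push_of_indep h]
  · by_cases ht : t = d.1 <;> simp [pop, push, h, ht, M.indep_irrefl]

theorem push_comm {d d' : T × Bool} (h : M.indep d.1 d'.1) (r : T → List (Option Bool)) :
    M.push d (M.push d' r) = M.push d' (M.push d r) := by
  have h' := M.indep_symm h
  funext t
  by_cases h1 : t = d.1
  · subst h1
    rw [push_self, push_of_indep h', push_of_indep h', push_self]
  · by_cases h2 : t = d'.1
    · subst h2
      rw [push_self, push_of_indep h, push_of_indep h, push_self]
    · simp only [push, h1, h2, if_false]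
      split_ifs <;> rfl

theorem pop_comm (t t' : T) (r : T → List (Option Bool)) :
    M.pop t (M.pop t' r) = M.pop t' (M.pop t r) := by
  funext t''
  simp only [pop]
  split_ifs <;> rfl

theorem Swap.pile_eq {w w' : List (T × Bool)} (h : M.Swap w w') : M.pile w = M.pile w' := by
  obtain ⟨u, z, d, d', hI, rfl, rfl⟩ := h
  simp [pile, push_comm hI]

theorem SwapEq.pile_eq {w w' : List (T × Bool)} (h : M.SwapEq w w') : M.pile w = M.pile w' := by
  induction h with
  | refl => rfl
  | tail _ h ih => exact ih.trans h.pile_eq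

/-- A later letter dependent on `d` would cover its sign with a marker or another sign. Hence all
letters after the occurrence on top are independent of `d`, and this occurrence moves to the end. -/
theorem swapEq_of_head {w : List (T × Bool)} {d : T × Bool}
    (h : (M.pile w d.1).head? = some (some d.2)) : ∃ u, M.SwapEq w (u ++ [d]) := by
  induction w using List.reverseRecOn with
  | nil => simp [pile] at h
  | append_singleton u c ih =>
    rw [pile_append_singleton] at h
    by_cases h1 : d.1 = c.1
    · rw [h1, push_self] at h
      have : c = d := Prod.ext h1.symm (by simpa using h)
      exact ⟨u, this ▸ .refl⟩
    · by_cases h2 : M.indep c.1 d.1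
      · rw [push_of_indep h2] at h
        obtain ⟨u', hu⟩ := ih h
        exact ⟨u' ++ [c], (hu.append [c]).tail ⟨u', [], d, c, M.indep_symm h2, by simp, by simp⟩⟩
      · simp [push, h1, h2] at h

/-- The last letter of one word tops its stack in the common piling, so it can be brought to the end
of the other word. Popping removes it from both, and induction applies. -/
theorem swapEq_of_pile_eq {w w' : List (T × Bool)} (h : M.pile w = M.pile w') : M.SwapEq w w' := by
  induction w' using List.reverseRecOn generalizing w with
  | nil =>
    rcases List.eq_nil_or_concat w with rfl | ⟨u, c, rfl⟩
    · exact .refl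
    · have := congrFun h c.1
      rw [List.concat_eq_append, pile_append_singleton, push_self] at this
      simp [pile] at this
  | append_singleton u d ih =>
    rw [pile_append_singleton] at h
    obtain ⟨u', hu⟩ := swapEq_of_head (w := w) (d := d) (by rw [h, push_self]; rfl)
    rw [hu.pile_eq, pile_append_singleton] at h
    have h' := congrArg (M.pop d.1) h
    rw [pop_push, pop_push] at h'
    exact hu.trans ((ih h').append [d])

theorem exists_push_of_head {w : List (T × Bool)} {d : T × Bool}
    (h : (M.pile w d.1).head? = some (some d.2)) :
    M.push d (M.pop d.1 (M.pile w)) = M.pile w ∧ ∃ u, M.pile u = M.pop d.1 (M.pile w) := by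
  obtain ⟨u, hu⟩ := swapEq_of_head h
  have := hu.pile_eq
  rw [pile_append_singleton] at this
  rw [this, pop_push]
  exact ⟨rfl, u, rfl⟩

theorem ValidPiling.push_pop {d : T × Bool} {r : T → List (Option Bool)} (hr : M.ValidPiling r)
    (h : (r d.1).head? = some (some !d.2)) : M.push (d.1, !d.2) (M.pop d.1 r) = r := by
  obtain ⟨⟨w, rfl⟩, -⟩ := hr
  exact (exists_push_of_head (d := (d.1, !d.2)) h).1

/-- A sign pushed directly onto its opposite is the very case in which `act` pops instead. Popping
keeps the chain condition, and its result is the piling of a shorter word by `exists_push_of_head`.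
-/
theorem ValidPiling.act {d : T × Bool} {r : T → List (Option Bool)} (hr : M.ValidPiling r) :
    M.ValidPiling (M.act d r) := by
  obtain ⟨⟨w, rfl⟩, hc⟩ := hr
  by_cases h : (M.pile w d.1).head? = some (some !d.2)
  · rw [IndependenceSystem.act, if_pos h]
    refine ⟨(exists_push_of_head (d := (d.1, !d.2)) h).2, fun t => ?_⟩
    rw [pop]
    split_ifs
    · exact hc t
    · exact (hc t).tail
  · rw [IndependenceSystem.act, if_neg h]
    refine ⟨⟨w ++ [d], pile_append_singleton _ _⟩, fun t => ?_⟩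
    rw [push]
    split_ifs with h1 h2
    · subst h1
      rw [List.isChain_cons]
      refine ⟨fun y hy ε hε hyε => h ?_, hc _⟩
      rw [Option.some.injEq] at hε
      rw [Option.mem_def] at hy
      rw [hy, hyε, hε]
    · exact hc t
    · rw [List.isChain_cons]
      exact ⟨fun y hy ε hε => by simp at hε, hc _⟩

/-- Signed letters act on reduced pilings by bijections. If the first letter cancels, the chain
condition keeps the uncovered entry from being cancelled by the inverse letter, which is therefore
pushed back. -/
theorem ValidPiling.act_flip {d : T × Bool} {r : T → List (Option Bool)} (hr : M.ValidPiling r) :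
    M.act (d.1, !d.2) (M.act d r) = r := by
  by_cases h : (r d.1).head? = some (some !d.2)
  · have hp := hr.push_pop h
    have hc := hr.2 d.1
    rw [IndependenceSystem.act, if_neg, IndependenceSystem.act, if_pos h, hp]
    rw [IndependenceSystem.act, if_pos h]
    rw [← hp] at hc
    have := push_self (M := M) (d.1, !d.2) (M.pop d.1 r)
    simp only at this
    rw [this, List.isChain_cons] at hc
    intro h'
    exact hc.1 _ h' _ rfl rfl
  · rw [IndependenceSystem.act, if_pos, IndependenceSystem.act, if_neg h]
    · exact pop_push (d := d) r
    rw [IndependenceSystem.act, if_neg h]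
    simp only
    rw [push_self]
    simp

theorem ValidPiling.pop_push_comm {d d' : T × Bool} {r : T → List (Option Bool)}
    (hr : M.ValidPiling r) (hI : M.indep d.1 d'.1) (h : (r d.1).head? = some (some !d.2)) :
    M.pop d.1 (M.push d' r) = M.push d' (M.pop d.1 r) := by
  have hp := hr.push_pop h
  conv_lhs => rw [← hp]
  rw [push_comm (d := d') (d' := (d.1, !d.2)) (M.indep_symm hI)]
  exact pop_push (d := (d.1, !d.2)) (M.push d' (M.pop d.1 r))

/-- Independent letters do not touch each other's stacks, so whether each is pushed or popped does
not depend on the order. Pushes and pops commute in each of the four cases. -/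
theorem ValidPiling.act_comm {d d' : T × Bool} {r : T → List (Option Bool)} (hr : M.ValidPiling r)
    (hI : M.indep d.1 d'.1) : M.act d (M.act d' r) = M.act d' (M.act d r) := by
  have hI' := M.indep_symm hI
  have e1 : M.act d' r d.1 = r d.1 := by
    rw [IndependenceSystem.act]
    split_ifs
    · exact pop_of_indep hI' r
    · exact push_of_indep hI' r
  have e2 : M.act d r d'.1 = r d'.1 := by
    rw [IndependenceSystem.act]
    split_ifs
    · exact pop_of_indep hI r
    · exact push_of_indep hI r
  rw [IndependenceSystem.act.eq_1 M d, e1, IndependenceSystem.act.eq_1 M d' (M.act d r), e2]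
  simp only [IndependenceSystem.act]
  split_ifs with h1 h2 h2
  · exact pop_comm _ _ _
  · exact hr.pop_push_comm hI h1
  · exact (hr.pop_push_comm hI' h2).symm
  · exact push_comm hI _

theorem validPiling_nil : M.ValidPiling fun _ => [] := ⟨⟨[], rfl⟩, fun _ => .nil⟩

variable (M)

/-- The product of a system with the group defined by its independence relation. -/
def unfolding : IndependenceSystem T where
  V := M.V × {r // M.ValidPiling r}
  indep := M.indep
  indep_irrefl := M.indep_irrefl
  indep_symm := M.indep_symm
  step v d w := M.step v.1 d w.1 ∧ w.2.1 = M.act d v.2.1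
  step_flip {v d w} h := ⟨M.step_flip h.1, by rw [h.2, v.2.2.act_flip]⟩
  step_det h h' := Prod.ext (M.step_det h.1 h'.1) (Subtype.ext (h.2.trans h'.2.symm))
  diamond {v d d' w w'} hI h h' := by
    obtain ⟨u, h1, h2⟩ := M.diamond hI h.1 h'.1
    refine ⟨⟨u, M.act d' w.2.1, w.2.2.act⟩, ⟨h1, rfl⟩, h2, ?_⟩
    change M.act d' w.2.1 = _
    rw [h.2, h'.2, v.2.2.act_comm hI]

variable {M}

/-- A path from the base point is homotopic to one whose word is reduced. -/
theorem exists_homotopic_reduced (f : M.V → T → List (Option Bool)) {v₀ v : M.complex.cube 0}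
    (h₀ : f (vtx₀ v₀) = fun _ => []) (hf : ∀ {v d w}, M.step v d w → f w = M.act d (f v))
    {p : List (M.complex.cube 1)} (hp : IsPath v₀ p v) :
    ∃ p', PathHomotopic v₀ v p p' ∧ M.pile (p'.map lbl) = f (vtx₀ v) := by
  induction p using List.reverseRecOn generalizing v with
  | nil =>
    obtain rfl : v₀ = v := hp
    exact ⟨[], .refl rfl, h₀.symm⟩
  | append_singleton p e ih =>
    obtain ⟨v₁, hp₁, rfl, rfl⟩ := isPath_append.1 hp
    obtain ⟨p', h1, h2⟩ := ih hp₁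
    have h3 := hf (step_edge e)
    have hh : PathHomotopic v₀ (target e) (p ++ [e]) (p' ++ [e]) := by
      have := h1.append (u := v₀) (l := []) (l' := [e]) (z := target e) rfl ⟨rfl, rfl⟩
      simpa using this
    -- If the new letter cancels in the piling, the reduced path can be rearranged to end in the
    -- reverse of `e`, and the resulting backtracking is deleted. Otherwise the extended word is
    -- still reduced.
    by_cases h : (f (vtx₀ (source e)) (lbl e).1).head? = some (some !(lbl e).2)
    · rw [act, if_pos h] at h3
      rw [← h2] at h
      obtain ⟨u, hu⟩ := swapEq_of_head (d := ((lbl e).1, !(lbl e).2)) h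
      obtain ⟨p'', h4, h5⟩ := homotopic_of_swapEq h1.2.1 hu
      obtain ⟨q, q', rfl, rfl, h6⟩ := List.map_eq_append_iff.1 h4
      obtain ⟨e', q', rfl, h7, h8⟩ := List.map_eq_cons_iff.1 h6
      obtain rfl := List.map_eq_nil_iff.1 h8
      obtain ⟨v₂, hq, h9, h10⟩ := isPath_append.1 h5.2.1
      have h10 : target e' = source e := h10
      have he : flip e' = e := by
        refine edge_ext ?_ ?_
        · rw [source_flip, h10]
        · rw [lbl_flip, h7]; simp [turn]
      have ht : target e = v₂ := by rw [← he, target_flip, h9]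
      refine ⟨q, (hh.trans ?_).trans
        (.of_elem ?_ ?_ (.inl ⟨q, [], e', rfl, (List.append_nil q).symm⟩)), ?_⟩
      · have := h5.append (u := v₀) (l := []) (l' := [e]) (z := target e) rfl ⟨rfl, rfl⟩
        simpa [he] using this
      · rw [List.append_nil]
        refine isPath_append.2 ⟨v₂, hq, h9, ?_, ?_⟩
        · rw [source_flip]
        · rw [he]; rfl
      · rw [ht]; exact hq
      · rw [h3, ← h2, hu.pile_eq, pile_append_singleton]
        exact (pop_push (d := ((lbl e).1, !(lbl e).2)) _).symm
    · rw [act, if_neg h] at h3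
      refine ⟨p' ++ [e], hh, ?_⟩
      rw [List.map_append, List.map_singleton, pile_append_singleton, h2, h3]

/-- An equivariant map to pilings lets the end vertex of a path from the base point determine the
piling of its reduced form. Two paths with the same end therefore have reduced forms that differ by
squares. -/
theorem isSimplyConnected_of_piling (f : M.V → T → List (Option Bool)) {v₀ : M.V}
    (h₀ : f v₀ = fun _ => []) (hf : ∀ {v d w}, M.step v d w → f w = M.act d (f v))
    (hc : ∀ v, M.Connected v₀ v) : M.complex.IsSimplyConnected := by
  have conn : ∀ v, ∃ p, IsPath (vertex v₀) p v := by
    intro v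
    suffices H : ∀ x, ∃ p, IsPath (vertex v₀) p (vertex x) by
      have := H (vtx₀ v)
      rwa [vertex_vtx₀] at this
    intro x
    induction hc x with
    | refl => exact ⟨[], rfl⟩
    | tail _ h ih =>
      obtain ⟨p, hp⟩ := ih
      obtain ⟨d, h⟩ := h
      obtain ⟨e, h1, -, h2⟩ := exists_edge h
      exact ⟨p ++ [e], isPath_append.2 ⟨_, hp, vtx₀_injective h1, vtx₀_injective h2⟩⟩
  have hom : ∀ v p q, IsPath (vertex v₀) p v → IsPath (vertex v₀) q v →
      PathHomotopic (vertex v₀) v p q := by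
    intro v p q hp hq
    obtain ⟨p', h1, h2⟩ := exists_homotopic_reduced f (v₀ := vertex v₀) h₀ hf hp
    obtain ⟨q', h3, h4⟩ := exists_homotopic_reduced f (v₀ := vertex v₀) h₀ hf hq
    exact (h1.trans (homotopic_of_swapEq' h1.2.1 h3.2.1
      (swapEq_of_pile_eq (h2.trans h4.symm)))).trans h3.symm
  refine ⟨⟨vertex v₀⟩, fun u v => ?_, fun v p => ?_⟩
  · obtain ⟨p, hp⟩ := conn u
    obtain ⟨q, hq⟩ := conn v
    exact ⟨_, isPath_append.2 ⟨_, isPath_reverse hp, hq⟩⟩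
  · obtain ⟨q, hq⟩ := conn v
    -- For `q` from the base point to `v`, the paths `q p` and `q` are homotopic; prepending the
    -- reverse of `q` contracts `p`.
    have h1 := hom v _ _ (isPath_append.2 ⟨_, hq, p.2⟩) hq
    have h2 := h1.append (l := (q.map flip).reverse) (l' := []) (isPath_reverse hq) rfl
    have h3 := reverse_append_homotopic hq
    have h4 := h3.append (u := v) (l := []) (l' := p.1) rfl p.2
    simp only [List.append_nil, List.nil_append, ← List.append_assoc] at h2 h4
    exact ((h4.symm.trans h2).trans h3).2.2

/-! ### The universal cover of a component -/

theorem connected_component {v₀ : M.V} (v : (M.component v₀).V) :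
    (M.component v₀).Connected ⟨v₀, .refl⟩ v := by
  obtain ⟨v, hv⟩ := v
  induction hv with
  | refl => exact .refl
  | tail _ h ih =>
    obtain ⟨d, h⟩ := h
    exact ih.tail ⟨d, h⟩

theorem Connected.fst {x y : M.unfolding.V} (h : M.unfolding.Connected x y) :
    M.Connected x.1 y.1 :=
  Relation.ReflTransGen.lift (p := fun v w => ∃ d, M.step v d w) Prod.fst
    (fun _ _ h' => h'.imp fun _ h => h.1) _ _ h

variable (M)

/-- The component of the unfolding over a state. -/
def cover (x₀ : M.V) : IndependenceSystem T :=
  M.unfolding.component (x₀, ⟨_, validPiling_nil⟩)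

/-- The covering map from the component of the unfolding. -/
def coverHom (x₀ : M.V) : Hom (M.cover x₀).complex (M.component x₀).complex :=
  homOfStep (M := M.component x₀) (M' := M.cover x₀) (fun v => ⟨v.1.1, Connected.fst v.2⟩) rfl
    fun h => h.1

/-- A step lifts by letting the same letter act on the piling, and the piling coordinate is itself
the equivariant map that yields simple connectedness. -/
theorem isUniversalCover_coverHom (x₀ : M.V) : (M.coverHom x₀).IsUniversalCover where
  covering := by
    refine isCovering_homOfStep (M := M.component x₀) (M' := M.cover x₀)
      (fun v => ⟨v.1.1, Connected.fst v.2⟩) rfl (fun h => h.1) ?_ ?_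
    · rintro ⟨x, hx⟩
      induction hx with
      | refl => exact ⟨⟨_, .refl⟩, rfl⟩
      | tail _ h ih =>
        obtain ⟨v, hv⟩ := ih
        obtain ⟨d, h⟩ := h
        obtain rfl := congrArg Subtype.val hv
        exact ⟨⟨⟨_, M.act d v.1.2.1, v.1.2.2.act⟩, v.2.tail ⟨d, h, rfl⟩⟩, rfl⟩
    · rintro v d w h
      exact ⟨⟨⟨w.1, M.act d v.1.2.1, v.1.2.2.act⟩, v.2.tail ⟨d, h, rfl⟩⟩, h, rfl⟩
  simply_connected :=
    isSimplyConnected_of_piling (M := M.cover x₀) (fun v => v.1.2.1)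
      (v₀ := ⟨(x₀, ⟨_, validPiling_nil⟩), .refl⟩) rfl (fun h => h.2) connected_component

theorem lift_orientation (x₀ : M.V) :
    (M.component x₀).orientation.lift (M.coverHom x₀) = (M.cover x₀).orientation := rfl

variable {M}

theorem reach_orientation {x y : M.complex.cube 0} :
    M.orientation.Reach x y ↔
      Relation.ReflTransGen (fun v w => ∃ t, M.step v (t, true) w) (vtx₀ x) (vtx₀ y) := by
  constructor
  · intro h
    refine Relation.ReflTransGen.lift (p := fun v w => ∃ t, M.step v (t, true) w) vtx₀ ?_ _ _ h
    rintro _ _ ⟨e, he, rfl, rfl⟩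
    have h' := step_edge e
    rw [← Prod.mk.eta (p := lbl e), show (lbl e).2 = true from he] at h'
    exact ⟨_, h'⟩
  · intro h
    rw [← vertex_vtx₀ x, ← vertex_vtx₀ y]
    refine Relation.ReflTransGen.lift (p := fun x y => ∃ e : M.complex.cube 1,
      M.orientation.pos e ∧ source e = x ∧ target e = y) vertex ?_ _ _ h
    rintro v w ⟨t, h⟩
    obtain ⟨e, h1, h2, h3⟩ := exists_edge h
    exact ⟨e, congrArg Prod.snd h2, vtx₀_injective h1, vtx₀_injective h3⟩

/-- The complex is already special, so its identity map serves as the cover. -/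
theorem isVirtuallySpecial_complex [Finite T] [Finite M.V] : M.complex.IsVirtuallySpecial :=
  ⟨M.isFinite_complex, M.isNPC_complex, M.complex, homOfStep _root_.id rfl _root_.id,
    M.isFinite_complex, M.isNPC_complex, M.isSpecial_complex,
    isCovering_homOfStep _ _ _ Function.surjective_id fun h => ⟨_, h⟩⟩

end IndependenceSystem

/-! ### Configurations, views and bounded time stamps -/

namespace EventStructure

open scoped Classical

variable {E : Type u} [PartialOrder E] (S : EventStructure E)

/-! ### Configurations and enabled events -/

/-- The events that can be added to a configuration. -/
def Enabled (c : Finset E) (e : E) : Prop :=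
  e ∉ c ∧ (∀ f ∈ c, ¬ S.conflict f e) ∧ ∀ f, f < e → f ∈ c

/-- The events below `e`. -/
noncomputable def causes (e : E) : Finset E := (S.finite_causes e).toFinset

/-- The events strictly below `e`. -/
noncomputable def past (e : E) : Finset E := (S.causes e).erase e

variable {S}

theorem mem_causes {e f : E} : f ∈ S.causes e ↔ f ≤ e := by simp [causes]

theorem mem_past {e f : E} : f ∈ S.past e ↔ f < e := by
  simp [past, mem_causes, lt_iff_le_and_ne, and_comm]

theorem insert_past (e : E) : insert e (S.past e) = S.causes e := by
  rw [past, Finset.insert_erase (mem_causes.2 le_rfl)]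

theorem isConfiguration_empty : S.IsConfiguration ∅ := by simp [IsConfiguration]

theorem isConfiguration_causes (e : E) : S.IsConfiguration (S.causes e) := by
  refine ⟨fun f hf g hg h => ?_, fun _ hf _ hg => mem_causes.2 (hg.trans (mem_causes.1 hf))⟩
  have h1 := S.conflict_inherit _ _ _ h (mem_causes.1 hg)
  exact S.conflict_irrefl _ (S.conflict_inherit _ _ _ (S.conflict_symm _ _ h1) (mem_causes.1 hf))

theorem IsConfiguration.of_subset {c d : Finset E} (hc : S.IsConfiguration c) (h : d ⊆ c)
    (hd : ∀ e ∈ d, ∀ e', e' ≤ e → e' ∈ d) : S.IsConfiguration d :=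
  ⟨fun e he f hf => hc.1 e (h he) f (h hf), hd⟩

theorem isConfiguration_past (e : E) : S.IsConfiguration (S.past e) :=
  (isConfiguration_causes e).of_subset (Finset.erase_subset _ _) fun _ hf _ hg =>
    mem_past.2 (hg.trans_lt (mem_past.1 hf))

theorem enabled_past (e : E) : S.Enabled (S.past e) e := by
  refine ⟨by simp [past], fun f hf h => ?_, fun f hf => mem_past.2 hf⟩
  exact (isConfiguration_causes e).1 f (mem_causes.2 (mem_past.1 hf).le) e
    (mem_causes.2 le_rfl) h

theorem IsConfiguration.insert {c : Finset E} {e : E} (hc : S.IsConfiguration c)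
    (he : S.Enabled c e) : S.IsConfiguration (insert e c) := by
  constructor
  · intro f hf g hg h
    rw [Finset.mem_insert] at hf hg
    rcases hf with rfl | hf <;> rcases hg with rfl | hg
    · exact S.conflict_irrefl _ h
    · exact he.2.1 g hg (S.conflict_symm _ _ h)
    · exact he.2.1 f hf h
    · exact hc.1 f hf g hg h
  · intro f hf g hg
    rw [Finset.mem_insert] at hf ⊢
    rcases hf with rfl | hf
    · rcases hg.eq_or_lt with rfl | hg
      · exact .inl rfl
      · exact .inr (he.2.2 g hg)
    · exact .inr (hc.2 f hf g hg)

theorem wellFounded_causes (S : EventStructure E) : WellFounded fun e f : E => e < f := by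
  refine Subrelation.wf (r := InvImage (· < ·) fun e => (S.causes e).card) ?_
    (InvImage.wf _ Nat.lt_wfRel.wf)
  intro e f h
  refine Finset.card_lt_card (Finset.ssubset_iff_subset_ne.2
    ⟨fun g hg => mem_causes.2 ((mem_causes.1 hg).trans h.le), fun he => ?_⟩)
  have : f ∈ S.causes e := he ▸ mem_causes.2 le_rfl
  exact (mem_causes.1 this).not_gt h

/-- Finiteness of the sets of causes supplies immediate successors, to which the labeling axiom for
`⋖` applies. -/
theorem exists_covBy_le (S : EventStructure E) {m y : E} (h : m < y) : ∃ z, m ⋖ z ∧ z ≤ y := by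
  obtain ⟨z, ⟨h1, h2⟩, hz⟩ := (wellFounded_causes S).has_min {z | m < z ∧ z ≤ y} ⟨y, h, le_rfl⟩
  exact ⟨z, ⟨h1, fun w hw hwz => hz w ⟨hw, hwz.le.trans h2⟩ hwz⟩, h2⟩

/-! ### Views -/

variable {L : Type} (lab : E → L)

/-- The least configuration that contains the events of `c` with labels in `A`. -/
noncomputable def view (A : Set L) (c : Finset E) : Finset E :=
  c.filter fun e => ∃ f ∈ c, lab f ∈ A ∧ e ≤ f

/-- The last event of `c` with label `g`. -/
noncomputable def last (g : L) (c : Finset E) : Option E :=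
  if h : ∃ m ∈ c, lab m = g ∧ ∀ f ∈ c, lab f = g → f ≤ m then some h.choose else none

variable {lab}

theorem mem_view {A : Set L} {c : Finset E} {e : E} :
    e ∈ view lab A c ↔ e ∈ c ∧ ∃ f ∈ c, lab f ∈ A ∧ e ≤ f := Finset.mem_filter

theorem view_subset (A : Set L) (c : Finset E) : view lab A c ⊆ c := Finset.filter_subset _ _

theorem mem_view_of_mem {A : Set L} {c : Finset E} {e : E} (h : e ∈ c) (hA : lab e ∈ A) :
    e ∈ view lab A c := mem_view.2 ⟨h, e, h, hA, le_rfl⟩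

theorem last_eq_some {g : L} {c : Finset E} {m : E} :
    last lab g c = some m ↔ m ∈ c ∧ lab m = g ∧ ∀ f ∈ c, lab f = g → f ≤ m := by
  constructor
  · intro h
    rw [last] at h
    split_ifs at h with h'
    rw [← Option.some.inj h]
    exact h'.choose_spec
  · intro h
    have h' : ∃ m ∈ c, lab m = g ∧ ∀ f ∈ c, lab f = g → f ≤ m := ⟨m, h⟩
    rw [last, dif_pos h', Option.some.injEq]
    obtain ⟨h1, h2, h3⟩ := h'.choose_spec
    exact le_antisymm (h.2.2 _ h1 h2) (h3 _ h.1 h.2.1)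

theorem IsConfiguration.view {c : Finset E} (hc : S.IsConfiguration c) (A : Set L) :
    S.IsConfiguration (view lab A c) :=
  hc.of_subset (view_subset A c) fun e he e' h => by
    obtain ⟨h1, f, h2, h3, h4⟩ := mem_view.1 he
    exact mem_view.2 ⟨hc.2 e h1 e' h, f, h2, h3, h.trans h4⟩

theorem view_mono {A : Set L} {c d : Finset E} (h : c ⊆ d) :
    EventStructure.view lab A c ⊆ EventStructure.view lab A d := fun e he => by
  obtain ⟨h1, f, h2, h3, h4⟩ := mem_view.1 he
  exact mem_view.2 ⟨h h1, f, h h2, h3, h4⟩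

theorem view_view_subset {A : Set L} {c d : Finset E} (hd : d ⊆ c)
    (h : EventStructure.view lab A c ⊆ d) :
    EventStructure.view lab A d = EventStructure.view lab A c := by
  refine (view_mono hd).antisymm fun e he => ?_
  obtain ⟨h1, f, h2, h3, h4⟩ := mem_view.1 he
  exact mem_view.2 ⟨h he, f, h (mem_view_of_mem h2 h3), h3, h4⟩

theorem view_empty (c : Finset E) : EventStructure.view lab ∅ c = ∅ := by
  ext e; simp [mem_view]

theorem view_union (A B : Set L) (c : Finset E) :
    EventStructure.view lab (A ∪ B) c =
      EventStructure.view lab A c ∪ EventStructure.view lab B c := by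
  ext e
  simp only [mem_view, Finset.mem_union, Set.mem_union]
  constructor
  · rintro ⟨h, f, hf, hA | hB, hle⟩
    · exact .inl ⟨h, f, hf, hA, hle⟩
    · exact .inr ⟨h, f, hf, hB, hle⟩
  · rintro (⟨h, f, hf, hA, hle⟩ | ⟨h, f, hf, hB, hle⟩)
    · exact ⟨h, f, hf, .inl hA, hle⟩
    · exact ⟨h, f, hf, .inr hB, hle⟩

theorem last_view_of_mem {g : L} {A : Set L} (hg : g ∈ A) (c : Finset E) :
    last lab g (EventStructure.view lab A c) = last lab g c := by
  ext m
  rw [last_eq_some, last_eq_some]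
  constructor
  · rintro ⟨h1, h2, h3⟩
    exact ⟨view_subset _ _ h1, h2, fun f hf hfg => h3 f (mem_view_of_mem hf (hfg ▸ hg)) hfg⟩
  · rintro ⟨h1, h2, h3⟩
    exact ⟨mem_view_of_mem h1 (h2 ▸ hg), h2, fun f hf hfg => h3 f (view_subset _ _ hf) hfg⟩

/-- A trace labeling over a trace alphabet. -/
structure IsTrace (S : EventStructure E) (lab : E → L) (I : L → L → Prop) : Prop extends
    S.IsTraceLabeling lab I where
  irrefl : ∀ a, ¬ I a a
  symm : ∀ a b, I a b → I b a

namespace IsTrace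

variable {I : L → L → Prop} (H : S.IsTrace lab I) {c : Finset E}
include H

theorem comparable (hc : S.IsConfiguration c) {e f : E} (he : e ∈ c) (hf : f ∈ c)
    (h : ¬ I (lab e) (lab f)) : e ≤ f ∨ f ≤ e := by
  rcases H.les3 e f h with h | h | h
  · exact .inl h
  · exact .inr h
  · exact absurd h (hc.1 e he f hf)

theorem comparable_of_eq (hc : S.IsConfiguration c) {e f : E} (he : e ∈ c) (hf : f ∈ c)
    (h : lab e = lab f) : e ≤ f ∨ f ≤ e := H.comparable hc he hf (h ▸ H.irrefl _)

theorem exists_last (hc : S.IsConfiguration c) {g : L} {e : E} (he : e ∈ c) (hg : lab e = g) :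
    ∃ m, last lab g c = some m ∧ e ≤ m := by
  obtain ⟨m, hle, hm⟩ := (c.filter fun e => lab e = g).exists_le_maximal
    (Finset.mem_filter.2 ⟨he, hg⟩)
  obtain ⟨h1, h2⟩ := Finset.mem_filter.1 hm.prop
  refine ⟨m, last_eq_some.2 ⟨h1, h2, fun f hf hfg => ?_⟩, hle⟩
  rcases H.comparable_of_eq hc hf h1 (hfg.trans h2.symm) with h | h
  · exact h
  · exact hm.2 (Finset.mem_filter.2 ⟨hf, hfg⟩) h

theorem mem_view_iff (hc : S.IsConfiguration c) {A : Set L} {e : E} :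
    e ∈ view lab A c ↔ ∃ g ∈ A, ∃ m, last lab g c = some m ∧ e ≤ m := by
  rw [mem_view]
  constructor
  · rintro ⟨-, f, hf, hA, hle⟩
    obtain ⟨m, hm, hfm⟩ := H.exists_last hc hf rfl
    exact ⟨_, hA, m, hm, hle.trans hfm⟩
  · rintro ⟨g, hg, m, hm, hle⟩
    rw [last_eq_some] at hm
    exact ⟨hc.2 m hm.1 e hle, m, hm.1, hm.2.1 ▸ hg, hle⟩

/-- The intersection of two views is generated by the last events on which the views agree. -/
theorem exists_common_last (hc : S.IsConfiguration c) {A B : Set L} {f : E}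
    (hA : f ∈ view lab A c) (hB : f ∈ view lab B c) :
    ∃ g m, last lab g (view lab A c) = some m ∧ last lab g (view lab B c) = some m ∧ f ≤ m := by
  -- A maximal common event above `f` turns out to be the last one with its label in both views.
  obtain ⟨m, hle, hm⟩ := (view lab A c ∩ view lab B c).exists_le_maximal
    (Finset.mem_inter.2 ⟨hA, hB⟩)
  obtain ⟨hmA, hmB⟩ := Finset.mem_inter.1 hm.prop
  have claim : ∀ A B : Set L, m ∈ view lab A c → m ∈ view lab B c →
      (∀ k, k ∈ view lab A c → k ∈ view lab B c → m ≤ k → k ≤ m) →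
        ∀ k ∈ view lab A c, lab k = lab m → k ≤ m := by
    intro A B hmA hmB hmax k hk hkm
    have hkc := view_subset _ _ hk
    rcases H.comparable_of_eq hc hkc (view_subset _ _ hmA) hkm with h | h
    · exact h
    refine hmax k hk ?_ h
    obtain ⟨hmc, y, hy, hyB, hmy⟩ := mem_view.1 hmB
    rcases hmy.eq_or_lt with rfl | hmy
    · exact mem_view_of_mem hkc (hkm ▸ hyB)
    -- The label of `z` depends on that of `m`, which is that of `k`, so `z` and `k` are comparable.
    -- If `k ≤ z`, then `k` lies in the `B`-view; if `z ≤ k`, then `z` lies in both views, against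
    -- the maximality of `m`.
    obtain ⟨z, hmz, hzy⟩ := exists_covBy_le S hmy
    have hzc := hc.2 y hy z hzy
    have hzB : z ∈ view lab B c := mem_view.2 ⟨hzc, y, hy, hyB, hzy⟩
    have hD : ¬ I (lab k) (lab z) := hkm ▸ H.les2 m z (.inl hmz)
    rcases H.comparable hc hkc hzc hD with h' | h'
    · exact (hc.view B).2 z hzB k h'
    · exact absurd (hmax z ((hc.view A).2 k hk z h') hzB hmz.le) hmz.lt.not_ge
  refine ⟨lab m, m, last_eq_some.2 ⟨hmA, rfl, ?_⟩, last_eq_some.2 ⟨hmB, rfl, ?_⟩, hle⟩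
  · exact claim A B hmA hmB fun k h1 h2 => hm.2 (Finset.mem_inter.2 ⟨h1, h2⟩)
  · exact claim B A hmB hmA fun k h1 h2 => hm.2 (Finset.mem_inter.2 ⟨h2, h1⟩)

end IsTrace

/-! ### Time stamps -/

/-- A time stamp that does not occur in the list. -/
noncomputable def freshStamp (F : L → Option (Option L)) : Option L :=
  Classical.epsilon fun k => ∀ h, F h ≠ some k

/-- There are `|L| + 1` stamps, and each of the `|L|` letters forbids at most one. -/
theorem freshStamp_spec [Finite L] (F : L → Option (Option L)) (h : L) :
    F h ≠ some (freshStamp F) := by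
  have : ∃ k, ∀ h, F h ≠ some k := by
    by_contra! hc
    choose g hg using hc
    have hinj : Function.Injective g := fun k k' h => by
      have h1 := hg k
      rw [h, hg k'] at h1
      exact (Option.some.inj h1).symm
    have := Nat.card_le_card_of_injective g hinj
    rw [Finite.card_option] at this
    omega
  exact Classical.epsilon_spec this h

variable (S lab) in
/-- The time stamp of an event differs from the stamps of the events with the same label that are
known to be last in the view of some label. -/
noncomputable def stamp : E → Option L :=
  (wellFounded_causes S).fix fun e ih => freshStamp fun h =>
    (last lab (lab e) (view lab {h} (S.past e))).map fun f =>
      if hf : f < e then ih f hf else none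

theorem stamp_eq (e : E) : S.stamp lab e = freshStamp fun h =>
    (last lab (lab e) (view lab {h} (S.past e))).map (S.stamp lab) := by
  rw [stamp, WellFounded.fix_eq]
  congr 1
  funext h
  refine Option.map_congr fun f hf => ?_
  rw [last_eq_some] at hf
  -- Events in a view of the past of `e` lie strictly below `e`, so the default `none` of the
  -- recursion is never taken.
  rw [dif_pos (mem_past.1 (view_subset _ _ hf.1))]

namespace IsTrace

variable {I : L → L → Prop} (H : S.IsTrace lab I) {c : Finset E}
include H

/-- By `exists_common_last`, the outdated event `f` is also the last one with its label in the view
of some letter `h` at the past of `e`. It is thus among the finitely many events whose stamps were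
avoided when `e` was stamped. -/
theorem stamp_ne_of_lt [Finite L] (hc : S.IsConfiguration c) {e f : E} {B : Set L} (he : e ∈ c)
    (hf : last lab (lab e) (view lab B c) = some f) (hlt : f < e) :
    S.stamp lab f ≠ S.stamp lab e := by
  rw [last_eq_some] at hf
  obtain ⟨hfB, hfe, hfm⟩ := hf
  have heB : e ∉ view lab B c := fun h => (hfm e h rfl).not_gt hlt
  -- In `c` the view of `lab e` may contain events later than `e`. Cutting down to `c'` makes this
  -- view equal to the causes of `e`, without changing the view of `B`.
  set c' := S.causes e ∪ view lab B c with hc'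
  have hsub : c' ⊆ c := Finset.union_subset (fun g hg => hc.2 e he g (mem_causes.1 hg))
    (view_subset _ _)
  have hconf : S.IsConfiguration c' := hc.of_subset hsub fun g hg k hk => by
    rw [hc', Finset.mem_union] at hg ⊢
    exact hg.imp ((isConfiguration_causes e).2 g · k hk) ((hc.view B).2 g · k hk)
  have hB : view lab B c' = view lab B c := view_view_subset hsub Finset.subset_union_right
  have hg : view lab {lab e} c' = S.causes e := by
    ext k
    rw [mem_view]
    constructor
    · rintro ⟨-, y, hy, hye, hky⟩
      rw [hc', Finset.mem_union] at hy
      rcases hy with hy | hy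
      · exact mem_causes.2 (hky.trans (mem_causes.1 hy))
      · exact mem_causes.2 (hky.trans ((hfm y hy hye).trans hlt.le))
    · intro hk
      exact ⟨Finset.mem_union_left _ hk, e, Finset.mem_union_left _ (mem_causes.2 le_rfl), rfl,
        mem_causes.1 hk⟩
  obtain ⟨h, m, h1, h2, h3⟩ := H.exists_common_last hconf (A := {lab e}) (B := B) (f := f)
    (by rw [hg]; exact mem_causes.2 hlt.le) (by rwa [hB])
  rw [hg] at h1
  rw [hB, last_eq_some] at h2
  rw [last_eq_some] at h1
  have hme : m < e := lt_of_le_of_ne (mem_causes.1 h1.1) fun h => heB (h ▸ h2.1)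
  have key : last lab (lab e) (view lab {h} (S.past e)) = some f := by
    rw [last_eq_some]
    refine ⟨mem_view.2 ⟨mem_past.2 hlt, m, mem_past.2 hme, h1.2.1, h3⟩, hfe, fun k hk hke => ?_⟩
    obtain ⟨-, y, hy, hyh, hky⟩ := mem_view.1 hk
    refine hfm k ((hc.view B).2 m h2.1 k (hky.trans ?_)) hke
    exact h1.2.2 y (mem_causes.2 (mem_past.1 hy).le) hyh
  intro heq
  rw [stamp_eq e] at heq
  refine freshStamp_spec (fun h =>
    (last lab (lab e) (view lab {h} (S.past e))).map (S.stamp lab)) h ?_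
  simp only [key, Option.map_some, heq]

/-- Time stamps distinguish the last events in different views. -/
theorem map_stamp_eq_iff [Finite L] (hc : S.IsConfiguration c) {A B : Set L} {g : L} :
    (last lab g (view lab A c)).map (S.stamp lab) = (last lab g (view lab B c)).map (S.stamp lab) ↔
      last lab g (view lab A c) = last lab g (view lab B c) := by
  refine ⟨fun h => ?_, fun h => by rw [h]⟩
  rcases hA : last lab g (view lab A c) with _ | e <;>
    rcases hB : last lab g (view lab B c) with _ | f
  · rfl
  · simp [hA, hB] at h
  · simp [hA, hB] at h
  · simp only [hA, hB, Option.map_some, Option.some.injEq] at h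
    obtain ⟨h1, rfl, -⟩ := last_eq_some.1 hA
    obtain ⟨h2, h3, -⟩ := last_eq_some.1 hB
    have he := view_subset _ _ h1
    have hf := view_subset _ _ h2
    rw [Option.some.injEq]
    by_contra hne
    rcases H.comparable_of_eq hc he hf h3.symm with h' | h'
    · exact H.stamp_ne_of_lt hc (B := A) hf (h3 ▸ hA) (lt_of_le_of_ne h' hne) h
    · exact H.stamp_ne_of_lt hc (B := B) he hB (lt_of_le_of_ne h' (Ne.symm hne)) h.symm

end IsTrace

end EventStructure

/-! ### Effects of sets of events and finite information about configurations -/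

namespace EventStructure

open scoped Classical

variable {E : Type u} [PartialOrder E] {S : EventStructure E}

/-! ### Linearizations -/

/-- `l` enumerates `s` without repetitions, every event after the events below it. -/
def Linearizes (l : List E) (s : Finset E) : Prop :=
  (∀ e, e ∈ l ↔ e ∈ s) ∧ l.Pairwise fun e f => ¬ f ≤ e

theorem exists_linearizes (s : Finset E) : ∃ l, Linearizes l s := by
  induction s using Finset.strongInduction with
  | H s ih =>
    rcases s.eq_empty_or_nonempty with rfl | hs
    · exact ⟨[], by simp, .nil⟩
    · obtain ⟨m, hm⟩ := s.exists_maximal hs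
      obtain ⟨l, h1, h2⟩ := ih _ (Finset.erase_ssubset hm.prop)
      refine ⟨l ++ [m], fun e => ?_, List.pairwise_append.2 ⟨h2, List.pairwise_singleton _ _, ?_⟩⟩
      · by_cases he : e = m
        · simp [he, hm.prop]
        · simp [he, h1]
      · intro e he f hf hle
        rw [List.mem_singleton] at hf
        subst hf
        obtain ⟨h3, h4⟩ := Finset.mem_erase.1 ((h1 e).1 he)
        exact h3 (le_antisymm (hm.2 h4 hle) hle)

theorem Linearizes.append {l l' : List E} {s t : Finset E} (h : Linearizes l s)
    (h' : Linearizes l' t) (hst : ∀ e ∈ s, ∀ f ∈ t, ¬ f ≤ e) : Linearizes (l ++ l') (s ∪ t) :=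
  ⟨fun e => by rw [List.mem_append, Finset.mem_union, h.1, h'.1],
    List.pairwise_append.2 ⟨h.2, h'.2, fun e he f hf => hst e ((h.1 e).1 he) f ((h'.1 f).1 hf)⟩⟩

variable {L : Type} {lab : E → L} {I : L → L → Prop}

/-- Two linearizations of the same conflict-free set have the same effect, if independent events
have commuting effects. -/
theorem foldl_eq_of_linearizes {M : Type*} (hlab : S.IsTraceLabeling lab I) {f : M → E → M}
    (hf : ∀ e e', I (lab e) (lab e') → ∀ m, f (f m e) e' = f (f m e') e) {s : Finset E}
    (hs : ∀ e ∈ s, ∀ e' ∈ s, ¬ S.conflict e e') {l l' : List E} (hl : Linearizes l s)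
    (hl' : Linearizes l' s) (m : M) : l.foldl f m = l'.foldl f m := by
  induction l generalizing s l' m with
  | nil =>
    cases l' with
    | nil => rfl
    | cons e l' => simpa using (hl.1 e).2 ((hl'.1 e).1 (by simp))
  | cons e l ih =>
    have hes : e ∈ s := (hl.1 e).1 (by simp)
    obtain ⟨p, q, rfl⟩ := List.append_of_mem ((hl'.1 e).2 hes)
    have hl2 := List.pairwise_cons.1 hl.2
    have hl'2 := List.pairwise_append.1 hl'.2
    have hel : e ∉ l := fun h => hl2.1 e h le_rfl
    have hepq : e ∉ p ++ q := fun h => by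
      rcases List.mem_append.1 h with h | h
      · exact hl'2.2.2 e h e (by simp) le_rfl
      · exact (List.pairwise_cons.1 hl'2.2.1).1 e h le_rfl
    -- The events of `p` come before `e` in one linearization and after it in the other, and do not
    -- conflict with it. So their labels are independent of that of `e`, which can be moved to the
    -- front.
    have hp : ∀ g ∈ p, I (lab e) (lab g) := by
      intro g hg
      have hgs : g ∈ s := (hl'.1 g).1 (by simp [hg])
      have h1 : ¬ e ≤ g := hl'2.2.2 g hg e (by simp)
      have hgl : g ∈ l := by
        rcases List.mem_cons.1 ((hl.1 g).2 hgs) with rfl | h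
        · exact absurd le_rfl h1
        · exact h
      by_contra hI
      rcases hlab.les3 e g hI with h | h | h
      · exact h1 h
      · exact hl2.1 g hgl h
      · exact hs e hes g hgs h
    have hcomm : ∀ (p : List E) (m : M), (∀ g ∈ p, I (lab e) (lab g)) →
        f (p.foldl f m) e = p.foldl f (f m e) := by
      intro p
      induction p with
      | nil => intros; rfl
      | cons g p ihp =>
        intro m hp
        rw [List.foldl_cons, ihp _ fun k hk => hp k (by simp [hk]), List.foldl_cons,
          hf e g (hp g (by simp))]
    rw [List.foldl_cons, List.foldl_append, List.foldl_cons, hcomm p m hp, ← List.foldl_append]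
    refine ih (s := s.erase e) (fun a ha b hb => hs a (Finset.mem_of_mem_erase ha) b
      (Finset.mem_of_mem_erase hb)) ⟨fun g => ?_, hl2.2⟩ ⟨fun g => ?_, ?_⟩ _
    · rw [Finset.mem_erase, ← hl.1, List.mem_cons]
      exact ⟨fun h => ⟨fun hge => hel (hge ▸ h), .inr h⟩, fun h => h.2.resolve_left h.1⟩
    · rw [Finset.mem_erase, ← hl'.1]
      constructor
      · intro h
        refine ⟨fun hge => hepq (hge ▸ h), ?_⟩
        rcases List.mem_append.1 h with h | h <;> simp [h]
      · rintro ⟨h1, h⟩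
        simpa [h1] using h
    · exact hl'.2.sublist (by simp)

/-- The effect of a conflict-free set of events. -/
noncomputable def foldEvents {M : Type*} (f : M → E → M) (s : Finset E) (m : M) : M :=
  (exists_linearizes s).choose.foldl f m

section

variable {M : Type*} {f : M → E → M} {s t : Finset E}

theorem foldEvents_empty (m : M) : foldEvents f ∅ m = m := by
  obtain ⟨h, -⟩ := (exists_linearizes (∅ : Finset E)).choose_spec
  rw [foldEvents]
  generalize (exists_linearizes (∅ : Finset E)).choose = l at h
  obtain rfl : l = [] := List.eq_nil_iff_forall_not_mem.2 fun e he => by simpa using (h e).1 he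
  rfl

theorem foldEvents_eq (hlab : S.IsTraceLabeling lab I)
    (hf : ∀ e e', I (lab e) (lab e') → ∀ m, f (f m e) e' = f (f m e') e)
    (hs : ∀ e ∈ s, ∀ e' ∈ s, ¬ S.conflict e e') {l : List E} (hl : Linearizes l s) (m : M) :
    foldEvents f s m = l.foldl f m :=
  foldl_eq_of_linearizes hlab hf hs (exists_linearizes s).choose_spec hl m

theorem foldEvents_union (hlab : S.IsTraceLabeling lab I)
    (hf : ∀ e e', I (lab e) (lab e') → ∀ m, f (f m e) e' = f (f m e') e)
    (hs : ∀ e ∈ s ∪ t, ∀ e' ∈ s ∪ t, ¬ S.conflict e e') (hst : ∀ e ∈ s, ∀ f ∈ t, ¬ f ≤ e) (m : M) :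
    foldEvents f (s ∪ t) m = foldEvents f t (foldEvents f s m) := by
  rw [foldEvents_eq hlab hf hs ((exists_linearizes s).choose_spec.append
    (exists_linearizes t).choose_spec hst), List.foldl_append]
  rfl

theorem foldEvents_singleton (e : E) (m : M) : foldEvents f {e} m = f m e := by
  obtain ⟨h1, h2⟩ := (exists_linearizes {e}).choose_spec
  rw [foldEvents]
  generalize (exists_linearizes {e}).choose = l at h1 h2
  cases l with
  | nil => simpa using (h1 e)
  | cons a l =>
    obtain rfl : a = e := by simpa using (h1 a).1 (by simp)
    cases l with
    | nil => rfl
    | cons b l =>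
      obtain rfl : b = a := by simpa using (h1 b).1 (by simp)
      simp at h2

end

/-! ### Finite information about configurations -/

/-- Information about a configuration: the time stamps of the last events in the views of the
letters, the order of the last events, and the effects of the complements of the views. -/
abbrev Info (L M : Type) : Type :=
  (L → L → Option (Option L)) × (L → L → Prop) × (Set L → M → M)

variable {M : Type} {act : L → M → M}

variable (S lab act) in
/-- The information about a configuration. -/
noncomputable def info (c : Finset E) : Info L M :=
  (fun g h => (last lab g (view lab {h} c)).map (S.stamp lab),
    fun g h => ∃ m n, last lab g c = some m ∧ last lab h c = some n ∧ m ≤ n,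
    fun G => foldEvents (fun m e => act (lab e) m) (c \ view lab G c))

namespace Info

/-- The letters whose last events agree. -/
def common (i j : Info L M) : Set L := {g | i.1 g g = j.1 g g}

/-- The letters whose last events in the second configuration belong to the first one. -/
def covered (i j : Info L M) : Set L := {g | j.1 g g = none ∨ ∃ h ∈ i.common j, j.2.1 g h}

/-- The letters that generate the intersection of the first configuration with a view of the
union. -/
def trunc (i j : Info L M) (G : Set L) : Set L :=
  {h | (h ∈ G ∧ h ∈ i.covered j) ∨ ∃ g ∈ G, g ∉ i.covered j ∧ i.1 h h = j.1 h g}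

/-- The information about a union of two views. -/
noncomputable def merge (i j : Info L M) : Info L M :=
  (fun g h => if h ∈ i.covered j then i.1 g h else j.1 g h,
    fun g h => if g ∈ i.covered j then
        if h ∈ i.covered j then i.2.1 g h else i.1 g g = j.1 g g ∧ j.2.1 g h
      else if h ∈ i.covered j then False else j.2.1 g h,
    fun G m => j.2.2 (i.common j ∪ {g | g ∈ G ∧ g ∉ i.covered j}) (i.2.2 (i.trunc j G) m))

/-- The information about a configuration after an event with label `a`. -/
noncomputable def extend (act : L → M → M) (a : L) (i : Info L M) : Info L M :=
  (fun g h => if h = a then if g = a then some (freshStamp fun h => i.1 a h) else i.1 g g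
      else i.1 g h,
    fun g h => if h = a then g = a ∨ i.1 g g ≠ none else g ≠ a ∧ i.2.1 g h,
    fun G m => if a ∈ G then m else act a (i.2.2 G m))

end Info

theorem info_one_self (c : Finset E) (g : L) :
    (S.info lab act c).1 g g = (last lab g c).map (S.stamp lab) := by
  simp only [info]
  rw [last_view_of_mem (Set.mem_singleton g)]

namespace IsTrace

variable (H : S.IsTrace lab I) {c : Finset E}
include H

theorem foldEvents_info (hact : ∀ a b, I a b → ∀ m, act a (act b m) = act b (act a m))
    {s t : Finset E} (hs : ∀ e ∈ s ∪ t, ∀ e' ∈ s ∪ t, ¬ S.conflict e e')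
    (hst : ∀ e ∈ s, ∀ f ∈ t, ¬ f ≤ e) (m : M) :
    foldEvents (fun m e => act (lab e) m) (s ∪ t) m =
      foldEvents (fun m e => act (lab e) m) t (foldEvents (fun m e => act (lab e) m) s m) :=
  foldEvents_union H.toIsTraceLabeling (fun _ _ h m => (hact _ _ h m).symm) hs hst m

/-- The information about a union of two views is determined by that about the views. -/
theorem info_union [Finite L] (hact : ∀ a b, I a b → ∀ m, act a (act b m) = act b (act a m))
    (hc : S.IsConfiguration c) {A B : Set L} (hAB : view lab (A ∪ B) c = c) :
    S.info lab act c = (S.info lab act (view lab A c)).merge (S.info lab act (view lab B c)) := by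
  set x := view lab A c with hx
  set y := view lab B c with hy
  set i := S.info lab act x with hi
  set j := S.info lab act y with hj
  have hcx : S.IsConfiguration x := hc.view A
  have hcy : S.IsConfiguration y := hc.view B
  have hxc : x ⊆ c := view_subset _ _
  have hyc : y ⊆ c := view_subset _ _
  have hun : ∀ e, e ∈ c ↔ e ∈ x ∨ e ∈ y := fun e => by
    rw [← Finset.mem_union, ← view_union, hAB]
  -- Both views lie in the configuration `c`, so equal stamps mean equal last events.
  have hK : ∀ g, g ∈ i.common j ↔ last lab g x = last lab g y := fun g => by
    change i.1 g g = j.1 g g ↔ _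
    rw [hi, hj, info_one_self, info_one_self]
    exact H.map_stamp_eq_iff hc
  have hord : ∀ g h, j.2.1 g h ↔ ∃ m n, last lab g y = some m ∧ last lab h y = some n ∧ m ≤ n :=
    fun _ _ => Iff.rfl
  -- An event of `y` lies in `x` exactly when it is below some event that is last in both views;
  -- stamps and the order of last events detect this.
  have hC : ∀ g, g ∈ i.covered j ↔ ∀ m, last lab g y = some m → m ∈ x := by
    intro g
    change (j.1 g g = none ∨ ∃ h ∈ i.common j, j.2.1 g h) ↔ _
    rw [hj, info_one_self, Option.map_eq_none_iff, ← hj]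
    constructor
    · rintro (h | ⟨h, hh, m, n, h1, h2, h3⟩) k hk
      · simp [h] at hk
      · obtain rfl : m = k := by simpa [h1] using hk
        rw [hK, h2, last_eq_some] at hh
        exact hcx.2 n hh.1 m h3
    · intro h
      rcases hl : last lab g y with _ | m
      · exact .inl rfl
      · obtain ⟨k, n, h1, h2, h3⟩ := H.exists_common_last hc (h m hl) (last_eq_some.1 hl).1
        exact .inr ⟨k, (hK k).2 (h1.trans h2.symm), m, n, hl, h2, h3⟩
  have hlx : ∀ g, g ∈ i.covered j → last lab g c = last lab g x := by
    intro g hg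
    ext m
    rw [last_eq_some, last_eq_some]
    rw [hC] at hg
    constructor
    · rintro ⟨h1, h2, h3⟩
      refine ⟨?_, h2, fun f hf => h3 f (hxc hf)⟩
      rcases (hun m).1 h1 with h | h
      · exact h
      · exact hg m (last_eq_some.2 ⟨h, h2, fun f hf => h3 f (hyc hf)⟩)
    · rintro ⟨h1, h2, h3⟩
      refine ⟨hxc h1, h2, fun f hf hfg => ?_⟩
      rcases (hun f).1 hf with h | h
      · exact h3 f h hfg
      · obtain ⟨k, hk, hle⟩ := H.exists_last hcy h hfg
        exact hle.trans (h3 k (hg k hk) (last_eq_some.1 hk).2.1)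
  have hly : ∀ g, g ∉ i.covered j → ∃ m, last lab g c = some m ∧ last lab g y = some m ∧ m ∉ x := by
    intro g hg
    rw [hC] at hg
    push Not at hg
    obtain ⟨m, hm, hmx⟩ := hg
    refine ⟨m, ?_, hm, hmx⟩
    rw [last_eq_some] at hm ⊢
    refine ⟨hyc hm.1, hm.2.1, fun f hf hfg => ?_⟩
    rcases (hun f).1 hf with h | h
    · rcases H.comparable_of_eq hc hf (hyc hm.1) (hfg.trans hm.2.1.symm) with h' | h'
      · exact h'
      · exact absurd (hcx.2 f h m h') hmx
    · exact hm.2.2 f h hfg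
  have hvx : ∀ g, g ∈ i.covered j → view lab {g} c = view lab {g} x := by
    intro g hg
    ext e
    rw [H.mem_view_iff hc, H.mem_view_iff hcx]
    simp [hlx g hg]
  have hvy : ∀ g, g ∉ i.covered j → view lab {g} c = view lab {g} y := by
    intro g hg
    ext e
    obtain ⟨m, h1, h2, -⟩ := hly g hg
    rw [H.mem_view_iff hc, H.mem_view_iff hcy]
    simp [h1, h2]
  refine Prod.ext ?_ (Prod.ext ?_ ?_)
  · funext g h
    simp only [Info.merge]
    split_ifs with hh
    · change (last lab g (view lab {h} c)).map _ = (last lab g (view lab {h} x)).map _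
      rw [hvx h hh]
    · change (last lab g (view lab {h} c)).map _ = (last lab g (view lab {h} y)).map _
      rw [hvy h hh]
  · funext g h
    apply propext
    change (∃ m n, last lab g c = some m ∧ last lab h c = some n ∧ m ≤ n) ↔ _
    simp only [Info.merge]
    split_ifs with hg hh hh
    · rw [hlx g hg, hlx h hh]; rfl
    · obtain ⟨n, h1, h2, h3⟩ := hly h hh
      rw [hlx g hg, h1, show (i.1 g g = j.1 g g) ↔ last lab g x = last lab g y from hK g, hord, h2]
      constructor
      · rintro ⟨m, n', h4, h5, h6⟩
        obtain rfl : n = n' := by simpa using h5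
        have hmc := (hlx g hg).trans h4
        rw [last_eq_some] at hmc h4 h2
        have hmy : m ∈ y := hcy.2 n h2.1 m h6
        have : last lab g y = some m :=
          last_eq_some.2 ⟨hmy, h4.2.1, fun f hf => hmc.2.2 f (hyc hf)⟩
        exact ⟨by rw [this, last_eq_some]; exact h4, m, n, this, rfl, h6⟩
      · rintro ⟨h4, m, n', h5, h6, h7⟩
        exact ⟨m, n', h4.trans h5, h6, h7⟩
    · rw [iff_false]
      rintro ⟨m, n, h1, h2, h3⟩
      obtain ⟨m', h4, -, h5⟩ := hly g hg
      obtain rfl : m' = m := by simpa [h4] using h1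
      rw [hlx h hh, last_eq_some] at h2
      exact h5 (hcx.2 n h2.1 _ h3)
    · obtain ⟨m, h1, h2, -⟩ := hly g hg
      obtain ⟨n, h3, h4, -⟩ := hly h hh
      rw [h1, h3, hord, h2, h4]
  · funext G m
    -- `trunc` generates the intersection of `x` with the `G`-view of `c`. For an uncovered `g`, the
    -- part of its view inside `x` is generated by common last events, which stamps recognise.
    have hT : ∀ p ∈ x, p ∈ view lab (i.trunc j G) x ↔ p ∈ view lab G c := by
      intro p hp
      rw [H.mem_view_iff hcx, H.mem_view_iff hc]
      constructor
      · rintro ⟨h, hh | ⟨g, hgG, hg, hh⟩, n, hn, hle⟩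
        · exact ⟨h, hh.1, n, (hlx h hh.2).trans hn, hle⟩
        · obtain ⟨k, hk, -⟩ := hly g hg
          refine ⟨g, hgG, k, hk, hle.trans ?_⟩
          have h1 : (last lab h x).map (S.stamp lab) =
              (last lab h (view lab {g} c)).map (S.stamp lab) := by
            rw [hvy g hg, ← info_one_self (act := act)]
            exact hh
          rw [H.map_stamp_eq_iff hc, hn] at h1
          obtain ⟨h2, -, -⟩ := last_eq_some.1 h1.symm
          obtain ⟨-, f, hf, hfg, hnf⟩ := mem_view.1 h2
          exact hnf.trans ((last_eq_some.1 hk).2.2 f hf hfg)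
      · rintro ⟨g, hgG, k, hk, hle⟩
        by_cases hg : g ∈ i.covered j
        · exact ⟨g, .inl ⟨hgG, hg⟩, k, (hlx g hg).symm.trans hk, hle⟩
        · obtain ⟨hkc, hkg, -⟩ := last_eq_some.1 hk
          have hpv : p ∈ view lab {g} c := mem_view.2 ⟨hxc hp, k, hkc, hkg, hle⟩
          obtain ⟨h, n, h1, h2, h3⟩ := H.exists_common_last hc hp hpv
          refine ⟨h, .inr ⟨g, hgG, hg, ?_⟩, n, h1, h3⟩
          rw [hi, info_one_self]
          change _ = (last lab h (view lab {g} y)).map _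
          rw [h1, ← hvy g hg, h2]
    -- Inside `y`, the common letters generate `x ∩ y`, and the uncovered letters of `G` account for
    -- the rest of the `G`-view.
    have hV : ∀ p ∈ y, p ∈ view lab (i.common j ∪ {g | g ∈ G ∧ g ∉ i.covered j}) y ↔
        p ∈ x ∨ p ∈ view lab G c := by
      intro p hp
      rw [H.mem_view_iff hcy, H.mem_view_iff hc (A := G)]
      constructor
      · rintro ⟨g, hg | ⟨hgG, hg⟩, n, hn, hle⟩
        · rw [hK, hn, last_eq_some] at hg
          exact .inl (hcx.2 n hg.1 p hle)
        · obtain ⟨k, h1, h2, -⟩ := hly g hg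
          rw [h2] at hn
          exact .inr ⟨g, hgG, n, h1.trans hn, hle⟩
      · have inter : p ∈ x → ∃ g ∈ i.common j ∪ {g | g ∈ G ∧ g ∉ i.covered j},
            ∃ m, last lab g y = some m ∧ p ≤ m := by
          intro hpx
          obtain ⟨k, n, h1, h2, h3⟩ := H.exists_common_last hc hpx hp
          exact ⟨k, .inl ((hK k).2 (h1.trans h2.symm)), n, h2, h3⟩
        rintro (hpx | ⟨g, hgG, k, hk, hle⟩)
        · exact inter hpx
        · by_cases hg : g ∈ i.covered j
          · rw [hlx g hg, last_eq_some] at hk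
            exact inter (hcx.2 k hk.1 p hle)
          · obtain ⟨k', h1, h2, -⟩ := hly g hg
            rw [h1] at hk
            exact ⟨g, .inr ⟨hgG, hg⟩, k, h2.trans hk, hle⟩
    -- The part in `x` can be executed first: the second part avoids `x`, which is downward closed,
    -- so none of its events lies below an event of the first.
    have hset : c \ view lab G c = (x \ view lab (i.trunc j G) x) ∪
        (y \ view lab (i.common j ∪ {g | g ∈ G ∧ g ∉ i.covered j}) y) := by
      ext p
      rw [Finset.mem_sdiff, Finset.mem_union, Finset.mem_sdiff, Finset.mem_sdiff, hun]
      constructor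
      · rintro ⟨h1 | h1, h2⟩
        · exact .inl ⟨h1, fun h => h2 ((hT p h1).1 h)⟩
        · by_cases h3 : p ∈ x
          · exact .inl ⟨h3, fun h => h2 ((hT p h3).1 h)⟩
          · exact .inr ⟨h1, fun h => ((hV p h1).1 h).elim h3 h2⟩
      · rintro (⟨h1, h2⟩ | ⟨h1, h2⟩)
        · exact ⟨.inl h1, fun h => h2 ((hT p h1).2 h)⟩
        · exact ⟨.inr h1, fun h => h2 ((hV p h1).2 (.inr h))⟩
    change foldEvents _ (c \ view lab G c) m = foldEvents _ _ (foldEvents _ _ m)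
    rw [hset]
    refine H.foldEvents_info hact ?_ ?_ m
    · rw [← hset]
      exact fun e he f hf => hc.1 e (Finset.mem_sdiff.1 he).1 f (Finset.mem_sdiff.1 hf).1
    · intro e he f hf hle
      rw [Finset.mem_sdiff] at he hf
      exact hf.2 ((hV f hf.1).2 (.inl (hcx.2 e he.1 f hle)))

/-- The information about the causes of an event is determined by that about its past. -/
theorem info_causes (hact : ∀ a b, I a b → ∀ m, act a (act b m) = act b (act a m)) (e : E) :
    S.info lab act (S.causes e) = (S.info lab act (S.past e)).extend act (lab e) := by
  have hcc := isConfiguration_causes (S := S) e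
  have hcp := isConfiguration_past (S := S) e
  have hsub : S.past e ⊆ S.causes e := Finset.erase_subset _ _
  have hmem : e ∈ S.causes e := mem_causes.2 le_rfl
  have hl : last lab (lab e) (S.causes e) = some e :=
    last_eq_some.2 ⟨hmem, rfl, fun f hf _ => mem_causes.1 hf⟩
  have hl' : ∀ g, g ≠ lab e → last lab g (S.causes e) = last lab g (S.past e) := by
    intro g hg
    ext m
    rw [last_eq_some, last_eq_some]
    have h1 : ∀ f, f ∈ S.causes e → lab f = g → f ∈ S.past e := fun f hf hfg =>
      Finset.mem_erase.2 ⟨fun h => hg (h ▸ hfg.symm), hf⟩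
    exact ⟨fun ⟨h2, h3, h4⟩ => ⟨h1 m h2 h3, h3, fun f hf => h4 f (hsub hf)⟩,
      fun ⟨h2, h3, h4⟩ => ⟨hsub h2, h3, fun f hf hfg => h4 f (h1 f hf hfg) hfg⟩⟩
  have hv : ∀ G, lab e ∈ G → view lab G (S.causes e) = S.causes e := fun G hG =>
    (view_subset _ _).antisymm fun f hf => mem_view.2 ⟨hf, e, hmem, hG, mem_causes.1 hf⟩
  have hv' : ∀ G, lab e ∉ G → view lab G (S.causes e) = view lab G (S.past e) := by
    intro G hG
    ext p
    rw [H.mem_view_iff hcc, H.mem_view_iff hcp]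
    refine exists_congr fun g => and_congr_right fun hg => ?_
    rw [hl' g fun h => hG (h ▸ hg)]
  refine Prod.ext ?_ (Prod.ext ?_ ?_)
  · funext g h
    change (last lab g (view lab {h} (S.causes e))).map _ = _
    simp only [Info.extend]
    split_ifs with hh hg
    -- The stamp of `e` is by construction a function of the stamps of last events in the views of
    -- its past, which is the information already stored.
    · subst hh hg
      rw [hv _ (Set.mem_singleton _), hl, Option.map_some, stamp_eq]
      rfl
    · subst hh
      rw [hv _ (Set.mem_singleton _), hl' g hg, info_one_self]
    · rw [hv' _ fun h' => hh (Eq.symm h')]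
      rfl
  · funext g h
    apply propext
    change (∃ m n, last lab g (S.causes e) = some m ∧ last lab h (S.causes e) = some n ∧ m ≤ n) ↔ _
    simp only [Info.extend]
    split_ifs with hh
    · subst hh
      rw [hl]
      by_cases hg : g = lab e
      · subst hg
        simp [hl]
      · rw [hl' g hg, info_one_self]
        simp only [hg, false_or, Ne, Option.map_eq_none_iff]
        constructor
        · rintro ⟨m, -, h1, -⟩
          simp [h1]
        · intro h1
          obtain ⟨m, hm⟩ := Option.ne_none_iff_exists'.1 h1
          exact ⟨m, e, hm, rfl, (mem_past.1 (last_eq_some.1 hm).1).le⟩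
    · rw [hl' h hh]
      by_cases hg : g = lab e
      · subst hg
        rw [hl]
        simp only [ne_eq, not_true_eq_false, false_and, iff_false]
        rintro ⟨m, n, h1, h2, h3⟩
        obtain rfl : e = m := by simpa using h1
        exact (mem_past.1 (last_eq_some.1 h2).1).not_ge h3
      · rw [hl' g hg]
        simp only [ne_eq, hg, not_false_eq_true, true_and]
        rfl
  · funext G m
    change foldEvents _ (S.causes e \ view lab G (S.causes e)) m = _
    simp only [Info.extend]
    split_ifs with hG
    · rw [hv G hG, Finset.sdiff_self, foldEvents_empty]
    · have hset : S.causes e \ view lab G (S.causes e) =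
          (S.past e \ view lab G (S.past e)) ∪ {e} := by
        rw [hv' G hG]
        ext p
        have h1 : e ∉ view lab G (S.past e) := fun h =>
          lt_irrefl e (mem_past.1 (view_subset _ _ h))
        rw [Finset.mem_sdiff, Finset.mem_union, Finset.mem_sdiff, Finset.mem_singleton,
          ← insert_past, Finset.mem_insert]
        constructor
        · tauto
        · rintro (h | rfl)
          · tauto
          · exact ⟨.inl rfl, h1⟩
      rw [hset, H.foldEvents_info hact, foldEvents_singleton]
      · rfl
      · rw [← hset]
        exact fun e he f hf => hcc.1 e (Finset.mem_sdiff.1 he).1 f (Finset.mem_sdiff.1 hf).1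
      · intro p hp f hf hle
        rw [Finset.mem_singleton] at hf
        subst hf
        exact (mem_past.1 (Finset.mem_sdiff.1 hp).1).not_ge hle

end IsTrace

end EventStructure

/-! ### Enabled events and the action of letters on residual classes -/

namespace EventStructure

open scoped Classical

variable {E : Type u} [PartialOrder E] {S : EventStructure E}
variable {L : Type} {lab : E → L} {I : L → L → Prop}

/-! ### Adding and removing events -/

theorem enabled_erase {c : Finset E} (hc : S.IsConfiguration c) {m : E} (hm : m ∈ c)
    (hmax : ∀ k ∈ c, m ≤ k → k ≤ m) : S.IsConfiguration (c.erase m) ∧ S.Enabled (c.erase m) m := by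
  refine ⟨hc.of_subset (Finset.erase_subset _ _) fun e he e' h => ?_, by simp, fun f hf =>
    hc.1 f (Finset.mem_of_mem_erase hf) m hm, fun f hf => ?_⟩
  · rw [Finset.mem_erase] at he ⊢
    refine ⟨?_, hc.2 e he.2 e' h⟩
    rintro rfl
    exact he.1 (le_antisymm (hmax e he.2 h) h)
  · exact Finset.mem_erase.2 ⟨hf.ne, hc.2 m hm f hf.le⟩

/-- A maximal event of `d \ c` is maximal in `d`, because `c` is downward closed; it can therefore
be taken as the last one added. -/
theorem IsConfiguration.induction_of_subset {c : Finset E} {P : Finset E → Prop} (h₀ : P c)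
    (hP : ∀ d e, c ⊆ d → S.IsConfiguration d → S.Enabled d e → P d → P (Insert.insert e d))
    {d : Finset E} (hc : S.IsConfiguration c) (hd : S.IsConfiguration d) (hcd : c ⊆ d) : P d := by
  induction d using Finset.strongInduction with
  | H d ih =>
    rcases (d \ c).eq_empty_or_nonempty with h | h
    · rwa [hcd.antisymm (Finset.sdiff_eq_empty_iff_subset.1 h)] at h₀
    · obtain ⟨m, hm⟩ := (d \ c).exists_maximal h
      obtain ⟨hmd, hmc⟩ := Finset.mem_sdiff.1 hm.prop
      obtain ⟨h1, h2⟩ := enabled_erase hd hmd fun k hk hmk =>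
        hm.2 (Finset.mem_sdiff.2 ⟨hk, fun hkc => hmc (hc.2 k hkc m hmk)⟩) hmk
      have h3 : c ⊆ d.erase m := fun k hk =>
        Finset.mem_erase.2 ⟨fun h => hmc (h ▸ hk), hcd hk⟩
      have := hP _ m h3 h1 h2 (ih _ (Finset.erase_ssubset hmd) h1 h3)
      rwa [Finset.insert_erase hmd] at this

theorem IsConfiguration.induction {P : Finset E → Prop} (h₀ : P ∅)
    (hP : ∀ d e, S.IsConfiguration d → S.Enabled d e → P d → P (Insert.insert e d))
    {d : Finset E} (hd : S.IsConfiguration d) : P d :=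
  IsConfiguration.induction_of_subset h₀ (fun d e _ => hP d e) isConfiguration_empty hd
    (Finset.empty_subset d)

/-- The configuration obtained by adding an enabled event. -/
noncomputable def Domain.add (c : S.Domain) {e : E} (he : S.Enabled c.1 e) : S.Domain :=
  ⟨insert e c.1, c.2.insert he⟩

namespace IsTrace

variable (H : S.IsTrace lab I) {c : Finset E} {e f : E}
include H

/-- Equal labels are dependent, and distinct events enabled together are not ordered. A conflict
between them would be minimal, as everything strictly below either event lies in `c`, and minimal
conflict excludes equal labels. -/
theorem enabled_unique (he : S.Enabled c e) (hf : S.Enabled c f) (h : lab e = lab f) : e = f := by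
  by_contra hne
  rcases H.les3 e f (h ▸ H.irrefl _) with h1 | h1 | h1
  · exact he.1 (hf.2.2 e (lt_of_le_of_ne h1 hne))
  · exact hf.1 (he.2.2 f (lt_of_le_of_ne h1 (Ne.symm hne)))
  · refine H.les1 e f ⟨h1, ?_⟩ h
    rintro ⟨k, hke, hkf, ⟨hle, hk⟩ | ⟨hle, hk⟩⟩
    · exact hf.2.1 k (he.2.2 k (lt_of_le_of_ne hle hke)) hk
    · exact he.2.1 k (hf.2.2 k (lt_of_le_of_ne hle hkf)) hk

/-- Were `e < f`, nothing could lie between them, and the axiom for `⋖` would make the labels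
dependent. So `f` does not need `e`. -/
theorem enabled_swap (hc : S.IsConfiguration c) (he : S.Enabled c e) (hf : S.Enabled (insert e c) f)
    (hI : I (lab e) (lab f)) : S.Enabled c f ∧ S.Enabled (insert f c) e := by
  have hef : ¬ e < f := by
    intro h
    refine H.les2 e f (.inl ⟨h, fun k hek hkf => ?_⟩) hI
    rcases Finset.mem_insert.1 (hf.2.2 k hkf) with rfl | hk
    · exact lt_irrefl _ hek
    · exact he.1 (hc.2 k hk e hek.le)
  refine ⟨⟨fun h => hf.1 (Finset.mem_insert_of_mem h),
    fun k hk => hf.2.1 k (Finset.mem_insert_of_mem hk), fun k hk => ?_⟩, ?_, ?_, ?_⟩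
  · rcases Finset.mem_insert.1 (hf.2.2 k hk) with rfl | h
    · exact absurd hk hef
    · exact h
  · rw [Finset.mem_insert, not_or]
    exact ⟨fun h => hf.1 (h ▸ Finset.mem_insert_self _ _), he.1⟩
  · intro k hk hke
    rcases Finset.mem_insert.1 hk with rfl | hk
    · exact hf.2.1 e (Finset.mem_insert_self _ _) (S.conflict_symm _ _ hke)
    · exact he.2.1 k hk hke
  · exact fun k hk => Finset.mem_insert_of_mem (he.2.2 k hk)


/-- The events on which an enabled event depends form its past. -/
theorem view_eq_past (hc : S.IsConfiguration c) (he : S.Enabled c e) :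
    view lab {b | ¬ I (lab e) b} c = S.past e := by
  ext k
  rw [mem_past, mem_view]
  constructor
  · rintro ⟨-, f, hf, hD, hkf⟩
    rcases H.les3 e f hD with h | h | h
    · exact absurd (hc.2 f hf e h) he.1
    · exact hkf.trans_lt (lt_of_le_of_ne h fun h => he.1 (h ▸ hf))
    · exact absurd (S.conflict_symm _ _ h) (he.2.1 f hf)
  · intro hk
    -- A maximal event of the past is an immediate predecessor of `e`, so its label depends on that
    -- of `e`.
    have : ∃ z ∈ S.past e, k ≤ z ∧ ∀ w ∈ S.past e, z ≤ w → w ≤ z := by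
      obtain ⟨z, hkz, hz⟩ := (S.past e).exists_le_maximal (mem_past.2 hk)
      exact ⟨z, hz.prop, hkz, fun w hw hzw => hz.2 hw hzw⟩
    obtain ⟨z, hz, hkz, hmax⟩ := this
    have hze := mem_past.1 hz
    refine ⟨he.2.2 k hk, z, he.2.2 z hze, fun h => ?_, hkz⟩
    refine H.les2 z e (.inl ⟨hze, fun w hzw hwe => ?_⟩) (H.symm _ _ h)
    exact (hmax w (mem_past.2 hwe) hzw.le).not_gt hzw

/-- A minimal event of `c` in conflict with `e` and with independent label would be in minimal
conflict with `e`, which is excluded. So its label is dependent, and it already lies in the view. -/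
theorem enabled_of_enabled_view (hc : S.IsConfiguration c)
    (he : S.Enabled (view lab {b | ¬ I (lab e) b} c) e) : S.Enabled c e := by
  refine ⟨fun h => he.1 (mem_view_of_mem h (H.irrefl _)), ?_,
    fun f hf => view_subset _ _ (he.2.2 f hf)⟩
  by_contra! hcon
  obtain ⟨f, ⟨hf, hfe⟩, hmin⟩ := (wellFounded_causes S).has_min
    {f | f ∈ c ∧ S.conflict f e} hcon
  have hD : ¬ I (lab e) (lab f) := by
    intro hI
    refine H.les2 f e (.inr ⟨hfe, ?_⟩) (H.symm _ _ hI)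
    rintro ⟨k, hkf, hke, ⟨hle, hk⟩ | ⟨hle, hk⟩⟩
    · exact hmin k ⟨hc.2 f hf k hle, hk⟩ (lt_of_le_of_ne hle hkf)
    · exact hc.1 k (view_subset _ _ (he.2.2 k (lt_of_le_of_ne hle hke))) f hf hk
  exact he.2.1 f (mem_view_of_mem hf hD) hfe

theorem view_singleton_past (hc : S.IsConfiguration c) (he : S.Enabled c e) {b : L}
    (hb : ¬ I (lab e) b) : view lab {b} (S.past e) = view lab {b} c := by
  refine view_view_subset (fun f hf => he.2.2 f (mem_past.1 hf)) ?_
  rw [← H.view_eq_past hc he]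
  intro k hk
  obtain ⟨h1, f, h2, h3, h4⟩ := mem_view.1 hk
  exact mem_view.2 ⟨h1, f, h2, (show lab f = b from h3) ▸ hb, h4⟩

theorem view_insert_self (hc : S.IsConfiguration c) (he : S.Enabled c e) :
    view lab {lab e} (insert e c) = S.causes e := by
  have hc' := hc.insert he
  ext k
  rw [mem_view, mem_causes]
  constructor
  · rintro ⟨-, f, hf, hfe, hkf⟩
    refine hkf.trans ?_
    rcases Finset.mem_insert.1 hf with rfl | hfc
    · exact le_rfl
    rcases H.comparable_of_eq hc' hf (Finset.mem_insert_self _ _) hfe with h | h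
    · exact h
    · exact absurd (hc.2 f hfc e h) he.1
  · intro hk
    exact ⟨hc'.2 e (Finset.mem_insert_self _ _) k hk, e, Finset.mem_insert_self _ _, rfl, hk⟩

omit H in
theorem _root_.EventStructure.view_insert_of_ne (hc : S.IsConfiguration c) {b : L}
    (hb : b ≠ lab e) : view lab {b} (insert e c) = view lab {b} c := by
  ext k
  rw [mem_view, mem_view]
  constructor
  · rintro ⟨-, f, hf, hfb, hkf⟩
    have hfc : f ∈ c := by
      rcases Finset.mem_insert.1 hf with rfl | h
      · exact absurd (show lab f = b from hfb).symm hb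
      · exact h
    exact ⟨hc.2 f hfc k hkf, f, hfc, hfb, hkf⟩
  · rintro ⟨h, f, hf, h'⟩
    exact ⟨Finset.mem_insert_of_mem h, f, Finset.mem_insert_of_mem hf, h'⟩

end IsTrace

/-! ### The action of the alphabet on the futures -/

/-- Enabled events are the minimal events of the rooted structure, so an isomorphism preserves them.
It then restricts to the events that remain after adding the one and its image. -/
theorem exists_enabled_of_equiv {c c' : S.Domain} (h : S.labeledFutureSetoid lab c c') {e : E}
    (he : S.Enabled c.1 e) : ∃ (e' : E) (he' : S.Enabled c'.1 e'), lab e' = lab e ∧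
      S.labeledFutureSetoid lab (c.add he) (c'.add he') := by
  obtain ⟨f, hf, hl⟩ := h
  have hr : e ∉ c.1 ∧ ¬ ∃ e' ∈ c.1, S.conflict e' e := ⟨he.1, fun ⟨k, hk, h⟩ => he.2.1 k hk h⟩
  set e₀ : S.Residual c := ⟨e, hr⟩ with he₀
  have he' : S.Enabled c'.1 (f e₀).1 := by
    refine ⟨(f e₀).2.1, fun k hk h => (f e₀).2.2 ⟨k, hk, h⟩, fun g hg => ?_⟩
    by_contra hgc
    have hgr : g ∉ c'.1 ∧ ¬ ∃ e' ∈ c'.1, S.conflict e' g :=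
      ⟨hgc, fun ⟨k, hk, h⟩ => (f e₀).2.2 ⟨k, hk, S.conflict_inherit _ _ _ h hg.le⟩⟩
    have h1 : f.symm ⟨g, hgr⟩ < e₀ := by
      rw [← f.lt_iff_lt, f.apply_symm_apply]
      exact hg
    exact (f.symm ⟨g, hgr⟩).2.1 (he.2.2 _ h1)
  have key : ∀ (c : S.Domain) (e : E) (he : S.Enabled c.1 e) (k : E),
      (k ∉ (c.add he).1 ∧ ¬ ∃ e' ∈ (c.add he).1, S.conflict e' k) ↔
        (k ∉ c.1 ∧ ¬ ∃ e' ∈ c.1, S.conflict e' k) ∧ k ≠ e ∧ ¬ S.conflict e k := by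
    intro c e he k
    simp only [Domain.add, Finset.mem_insert, not_or, exists_eq_or_imp]
    tauto
  refine ⟨_, he', hl e₀, ?_⟩
  let F : S.Residual (c.add he) ≃o S.Residual (c'.add he') :=
    { toFun := fun k => ⟨(f ⟨k.1, ((key c e he k.1).1 k.2).1⟩).1, (key c' _ he' _).2
        ⟨(f _).2, fun h => ((key c e he k.1).1 k.2).2.1
            (congrArg Subtype.val (f.injective (Subtype.ext h))),
          fun h => ((key c e he k.1).1 k.2).2.2 ((hf e₀ _).2 h)⟩⟩
      invFun := fun k => ⟨(f.symm ⟨k.1, ((key c' _ he' k.1).1 k.2).1⟩).1, (key c _ he _).2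
        ⟨(f.symm _).2, fun h => ((key c' _ he' k.1).1 k.2).2.1 (by
            have h1 : f.symm ⟨k.1, ((key c' _ he' k.1).1 k.2).1⟩ = e₀ := Subtype.ext h
            exact (congrArg Subtype.val (f.apply_symm_apply _)).symm.trans
              (congrArg (fun x => (f x).1) h1)),
          fun h => ((key c' _ he' k.1).1 k.2).2.2 (by
            have h1 := (hf e₀ (f.symm ⟨k.1, ((key c' _ he' k.1).1 k.2).1⟩)).1 h
            rw [f.apply_symm_apply] at h1
            exact h1)⟩⟩
      left_inv := fun k => Subtype.ext (by simp)
      right_inv := fun k => Subtype.ext (by simp)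
      map_rel_iff' := fun {a b} => f.le_iff_le (x := ⟨a.1, _⟩) (y := ⟨b.1, _⟩) }
  exact ⟨F, fun a b => hf ⟨a.1, _⟩ ⟨b.1, _⟩, fun a => hl ⟨a.1, _⟩⟩

variable {Q : Type} (q : S.Domain → Q)

variable (lab) in
/-- The futures that are reached from a set of futures by an event with label `a`. -/
def stepFutures (a : L) (s : Set Q) : Set Q :=
  {p | ∃ (c : S.Domain) (e : E) (he : S.Enabled c.1 e), q c ∈ s ∧ lab e = a ∧ p = q (c.add he)}

namespace IsTrace

variable (H : S.IsTrace lab I) {q} (hq : ∀ c c', q c = q c' ↔ S.labeledFutureSetoid lab c c')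
include H hq

/-- Acting on sets of residual classes makes the partial transitions total, so commutation needs no
enabledness hypothesis. The second event is transported to an actual extension of `c`, where
`enabled_swap` applies. -/
theorem stepFutures_comm (a b : L) (hI : I a b) (s : Set Q) :
    stepFutures lab q a (stepFutures lab q b s) = stepFutures lab q b (stepFutures lab q a s) := by
  suffices h : ∀ a b, I a b →
      stepFutures lab q a (stepFutures lab q b s) ⊆ stepFutures lab q b (stepFutures lab q a s) from
    (h a b hI).antisymm (h b a (H.symm _ _ hI))
  rintro a b hI _ ⟨d, f, hf, ⟨c, e, he, hc, rfl, hd⟩, rfl, rfl⟩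
  obtain ⟨f', hf', hl, hr⟩ := exists_enabled_of_equiv ((hq _ _).1 hd) hf
  rw [← hq] at hr
  obtain ⟨h1, h2⟩ := H.enabled_swap c.2 he hf' (hl ▸ H.symm _ _ hI)
  refine ⟨c.add h1, e, h2, ⟨c, f', h1, hc, hl, rfl⟩, rfl, hr.trans (congrArg q (Subtype.ext ?_))⟩
  exact Finset.insert_comm _ _ _

theorem stepFutures_singleton (c : S.Domain) {e : E} (he : S.Enabled c.1 e) :
    stepFutures lab q (lab e) {q c} = {q (c.add he)} := by
  ext p
  rw [Set.mem_singleton_iff]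
  constructor
  · rintro ⟨d, f, hf, hd, hl, rfl⟩
    obtain ⟨f', hf', hl', hr⟩ := exists_enabled_of_equiv ((hq _ _).1 hd) hf
    obtain rfl := H.enabled_unique hf' he (hl'.trans hl)
    exact (hq _ _).2 hr
  · rintro rfl
    exact ⟨c, e, he, rfl, rfl, rfl⟩

theorem foldEvents_futures (c : S.Domain) :
    foldEvents (fun m e => stepFutures lab q (lab e) m) c.1 {q ⟨∅, isConfiguration_empty⟩} =
      {q c} := by
  obtain ⟨c, hc⟩ := c
  refine hc.induction (P := fun c => ∀ hc : S.IsConfiguration c,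
    foldEvents (fun m e => stepFutures lab q (lab e) m) c {q ⟨∅, isConfiguration_empty⟩} =
      {q ⟨c, hc⟩}) (fun _ => foldEvents_empty _) (fun d e hd he ih hd' => ?_) hc
  have hu : insert e d = d ∪ {e} := by rw [Finset.union_comm]; rfl
  refine Eq.trans ?_ (H.stepFutures_singleton hq ⟨d, hd⟩ he)
  rw [← ih hd, hu, H.foldEvents_info, foldEvents_singleton]
  · exact fun a b hI m => H.stepFutures_comm hq a b hI m
  · rw [← hu]; exact hd'.1
  · intro k hk f hf hle
    rw [Finset.mem_singleton] at hf
    exact he.1 (hf ▸ hd.2 k hk f hle)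

/-- The view of the empty set of letters is empty, so the effect stored at `∅` is that of the whole
configuration; applied to the initial class it returns the class reached. -/
theorem future_eq_of_info_eq {c c' : S.Domain}
    (h : S.info lab (stepFutures lab q) c.1 = S.info lab (stepFutures lab q) c'.1) :
    q c = q c' := by
  have h1 := congrFun (congrFun (congrArg (fun i => i.2.2) h) ∅) {q ⟨∅, isConfiguration_empty⟩}
  simp only [info, view_empty, Finset.sdiff_empty] at h1
  rw [H.foldEvents_futures hq, H.foldEvents_futures hq] at h1
  exact Set.singleton_injective h1

/-- Cells hold the views of single letters, while enabledness depends on the joint view of many.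
Adding letters one at a time with `info_union` bridges the two. -/
theorem info_view_eq [Finite L] {c c' : Finset E} (hc : S.IsConfiguration c)
    (hc' : S.IsConfiguration c') (A : Set L)
    (h : ∀ a ∈ A, S.info lab (stepFutures lab q) (view lab {a} c) =
      S.info lab (stepFutures lab q) (view lab {a} c')) :
    S.info lab (stepFutures lab q) (view lab A c) =
      S.info lab (stepFutures lab q) (view lab A c') := by
  induction A, A.toFinite using Set.Finite.induction_on with
  | empty => rw [view_empty, view_empty]
  | @insert a A _ _ ih =>
    have key : ∀ {c : Finset E}, S.IsConfiguration c →
        S.info lab (stepFutures lab q) (view lab (insert a A) c) =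
          (S.info lab (stepFutures lab q) (view lab {a} c)).merge
            (S.info lab (stepFutures lab q) (view lab A c)) := by
      intro c hc
      have hv : ∀ B ⊆ insert a A, view lab B (view lab (insert a A) c) = view lab B c := by
        intro B hB
        refine view_view_subset (view_subset _ _) fun k hk => ?_
        obtain ⟨h1, f, h2, h3, h4⟩ := mem_view.1 hk
        exact mem_view.2 ⟨h1, f, h2, hB h3, h4⟩
      have h1 := H.info_union (A := {a}) (B := A) (H.stepFutures_comm hq) (hc.view (insert a A))
        (hv _ subset_rfl)
      rwa [hv _ (Set.singleton_subset_iff.2 (Set.mem_insert _ _)), hv _ (Set.subset_insert _ _)]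
        at h1
    rw [key hc, key hc', h a (Set.mem_insert _ _),
      ih fun b hb => h b (Set.mem_insert_of_mem _ hb)]

/-- If the information about the past of `e` agrees with the information about the events of `c` on
which an event with the label of `e` depends, then such an event is enabled. -/
theorem exists_enabled_of_info_eq [Finite L] {c : Finset E} (hc : S.IsConfiguration c) {e : E}
    (h : ∀ b, ¬ I (lab e) b → S.info lab (stepFutures lab q) (view lab {b} c) =
      S.info lab (stepFutures lab q) (view lab {b} (S.past e))) :
    ∃ e', S.Enabled c e' ∧ lab e' = lab e ∧
      S.info lab (stepFutures lab q) (S.causes e') =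
        S.info lab (stepFutures lab q) (S.causes e) := by
  have hp := isConfiguration_past (S := S) e
  have h1 := H.info_view_eq hq hc hp {b | ¬ I (lab e) b} h
  rw [H.view_eq_past hp (enabled_past e)] at h1
  -- Equal information gives isomorphic futures, so the enabled event at the past of `e` has a
  -- counterpart at the dependent view of `c`, which is then enabled at `c` itself.
  have h2 := H.future_eq_of_info_eq hq (c := ⟨_, hc.view _⟩) (c' := ⟨_, hp⟩) h1
  obtain ⟨e', he', hl, -⟩ := exists_enabled_of_equiv ((hq _ _).1 h2.symm) (enabled_past e)
  have he : S.Enabled c e' := H.enabled_of_enabled_view hc (by rw [hl]; exact he')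
  refine ⟨e', he, hl, ?_⟩
  have hact := fun a b hI m => H.stepFutures_comm hq a b hI m
  rw [H.info_causes hact, H.info_causes hact, hl, ← h1, ← H.view_eq_past hc he, hl]

end IsTrace
end EventStructure

/-! ### The finite system of cells and the pilings of configurations -/

open scoped Classical in
/-- The system on an array of cells indexed by `L`: the transition `(a, pre, post)` is enabled if
the cells dependent on `a` have the contents `pre`, and it changes the contents of the cell `a`
to `post`. -/
noncomputable def IndependenceSystem.ofCells {L K : Type} (I : L → L → Prop) (hI : ∀ a, ¬ I a a)
    (hI' : ∀ a b, I a b → I b a) (R : Set (L × (L → K) × K)) :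
    IndependenceSystem (L × (L → K) × K) where
  V := L → K
  indep t t' := I t.1 t'.1
  indep_irrefl t := hI t.1
  indep_symm h := hI' _ _ h
  -- A reversed step finds `post` in the cell `a` and restores `pre` there. The other dependent
  -- cells are read but not written, so both directions compare them with `pre`.
  step x d y := d.1 ∈ R ∧ (∀ b, ¬ I d.1.1 b → b ≠ d.1.1 → x b = d.1.2.1 b) ∧
    x d.1.1 = (if d.2 then d.1.2.1 d.1.1 else d.1.2.2) ∧
      y = Function.update x d.1.1 (if d.2 then d.1.2.2 else d.1.2.1 d.1.1)
  step_flip {v d w} := by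
    rintro ⟨h1, h2, h3, rfl⟩
    refine ⟨h1, fun b hb hba => ?_, ?_, ?_⟩
    · rw [Function.update_of_ne hba, h2 b hb hba]
    · cases d.2 <;> simp
    · rw [Function.update_idem, eq_comm, Function.update_eq_self_iff, h3]
      cases d.2 <;> simp
  step_det h h' := h.2.2.2.trans h'.2.2.2.symm
  diamond {v d d' w w'} hd := by
    rintro ⟨h1, h2, h3, rfl⟩ ⟨h1', h2', h3', rfl⟩
    -- Each transition writes only to its own cell, which an independent transition neither reads
    -- nor writes.
    have hne : d.1.1 ≠ d'.1.1 := fun h => hI _ (h ▸ hd)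
    refine ⟨_, ⟨h1', fun b hb hba => ?_, ?_, rfl⟩, h1, fun b hb hba => ?_, ?_, ?_⟩
    · have hbd : b ≠ d.1.1 := by
        rintro rfl
        exact hb (hI' _ _ hd)
      rw [Function.update_of_ne hbd, h2' b hb hba]
    · rw [Function.update_of_ne hne.symm, h3']
    · have hbd : b ≠ d'.1.1 := by
        rintro rfl
        exact hb hd
      rw [Function.update_of_ne hbd, h2 b hb hba]
    · rw [Function.update_of_ne hne, h3]
    · exact Function.update_comm hne _ _ _

namespace EventStructure

open scoped Classical
open IndependenceSystem

variable {E : Type u} [PartialOrder E] {S : EventStructure E}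
variable {L : Type} {lab : E → L} {I : L → L → Prop}

section

variable {Q : Type} (q : S.Domain → Q)

variable (lab) in
/-- The information stored in the cells at a configuration. -/
noncomputable def cells (c : Finset E) : L → Info L (Set Q) :=
  fun b => S.info lab (stepFutures lab q) (view lab {b} c)

/-- The transitions of the cells. -/
abbrev CellTransition (L Q : Type) : Type := L × (L → Info L (Set Q)) × Info L (Set Q)

variable (lab I) in
/-- The transition of the cells that corresponds to an event. -/
noncomputable def transition (e : E) : CellTransition L Q :=
  (lab e, fun b => if I (lab e) b then cells lab q ∅ b else cells lab q (S.past e) b,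
    S.info lab (stepFutures lab q) (S.causes e))

namespace IsTrace

variable (H : S.IsTrace lab I)

/-- The system of cells associated with a trace-regular event structure. -/
noncomputable def system : IndependenceSystem (CellTransition L Q) :=
  IndependenceSystem.ofCells I H.irrefl H.symm (Set.range (transition lab I q))

variable {q} {c : Finset E} {e : E}

-- Adding `e` changes only the view of its own label, and the dependent views at `c` agree with
-- those at the past of `e`.
include H in
theorem step_cells (hc : S.IsConfiguration c) (he : S.Enabled c e) :
    (H.system q).step (cells lab q c) (transition lab I q e, true) (cells lab q (insert e c)) := by
  have hpre : ∀ b, ¬ I (lab e) b → cells lab q c b = (transition lab I q e).2.1 b := by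
    intro b hb
    simp only [transition, if_neg hb, cells]
    rw [H.view_singleton_past hc he hb]
  refine ⟨⟨e, rfl⟩, fun b hb _ => hpre b hb, hpre _ (H.irrefl _), ?_⟩
  change cells lab q (insert e c) = Function.update (cells lab q c) (lab e)
    (S.info lab (stepFutures lab q) (S.causes e))
  rw [eq_comm, Function.update_eq_iff]
  refine ⟨?_, fun b hb => ?_⟩
  · rw [cells, H.view_insert_self hc he]
  · rw [cells, cells, view_insert_of_ne hc hb]

/-- With `step_cells`, this shows that positive steps from the state of a configuration are exactly
its enabled events, so the filter contains no spurious states. -/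
theorem exists_enabled_of_step [Finite L]
    (hq : ∀ c c', q c = q c' ↔ S.labeledFutureSetoid lab c c') (hc : S.IsConfiguration c)
    {t : CellTransition L Q} {y : L → Info L (Set Q)}
    (h : (H.system q).step (cells lab q c) (t, true) y) :
    ∃ e, S.Enabled c e ∧ transition lab I q e = t := by
  obtain ⟨⟨e, rfl⟩, h1, h2, -⟩ := h
  have h3 : ∀ b, ¬ I (lab e) b → cells lab q c b = cells lab q (S.past e) b := by
    intro b hb
    have : cells lab q c b = (transition lab I q e).2.1 b := by
      by_cases hbe : b = lab e
      · subst hbe; exact h2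
      · exact h1 b hb hbe
    rw [this]
    simp only [transition, if_neg hb]
  obtain ⟨e', he', hl, hi⟩ := H.exists_enabled_of_info_eq hq hc h3
  refine ⟨e', he', ?_⟩
  refine Prod.ext hl (Prod.ext (funext fun b => ?_) hi)
  -- On cells independent of the label, which are not read, `transition` stores the fixed value at
  -- `∅`. This makes the transitions of the two events literally equal.
  simp only [transition, hl]
  split_ifs with hb
  · rfl
  · rw [← h3 b hb, cells, cells, H.view_singleton_past hc he' (by rwa [hl])]

variable (q) in
/-- The piling of a configuration. -/
noncomputable def piling (c : Finset E) :
    CellTransition L Q → List (Option Bool) :=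
  foldEvents (fun r e => (H.system q).push (transition lab I q e, true) r) c fun _ => []

theorem piling_insert (hc : S.IsConfiguration c) (he : S.Enabled c e) :
    H.piling q (insert e c) =
      (H.system q).push (transition lab I q e, true) (H.piling q c) := by
  have hu : insert e c = c ∪ {e} := by rw [Finset.union_comm]; rfl
  rw [piling, hu, foldEvents_union H.toIsTraceLabeling, foldEvents_singleton]
  · rfl
  · exact fun e e' hI m =>
      push_comm (M := H.system q) (d := (transition lab I q e', true)) (H.symm _ _ hI) m
  · rw [← hu]; exact (hc.insert he).1
  · intro k hk f hf hle
    rw [Finset.mem_singleton] at hf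
    exact he.1 (hf ▸ hc.2 k hk f hle)

theorem piling_empty : H.piling q ∅ = fun _ => [] := foldEvents_empty _

/-- Configurations give positive words, so `act` never cancels along them. -/
theorem false_notMem_piling (hc : S.IsConfiguration c) :
    ∀ t, some false ∉ H.piling q c t := by
  refine hc.induction (P := fun c => ∀ t, some false ∉ H.piling q c t) ?_ fun d e hd he ih t => ?_
  · rw [piling_empty]; simp
  · rw [H.piling_insert hd he, push]
    split_ifs <;> simp [ih t]

theorem act_piling (hc : S.IsConfiguration c) (he : S.Enabled c e) :
    (H.system q).act (transition lab I q e, true) (H.piling q c) = H.piling q (insert e c) := by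
  rw [H.piling_insert hc he, act, if_neg]
  intro h
  exact H.false_notMem_piling hc _ (List.mem_of_mem_head? h)

theorem validPiling_piling (hc : S.IsConfiguration c) :
    (H.system q).ValidPiling (H.piling q c) := by
  refine hc.induction (P := fun c => (H.system q).ValidPiling (H.piling q c)) ?_
    fun d e hd he ih => ?_
  · rw [piling_empty]; exact validPiling_nil
  · rw [← H.act_piling hd he]; exact ih.act

variable (lab I q) in
/-- The word `w` labels a sequence of events that leads from `c` to `d`. -/
def _root_.EventStructure.Spells : Finset E → List (CellTransition L Q × Bool) →
    Finset E → Prop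
  | c, [], d => c = d
  | c, t :: w, d => ∃ e, S.Enabled c e ∧ (transition lab I q e, true) = t ∧ Spells (insert e c) w d

omit H in
theorem _root_.EventStructure.spells_append
    {w w' : List (CellTransition L Q × Bool)} {c d : Finset E} :
    Spells lab I q c (w ++ w') d ↔ ∃ k, Spells lab I q c w k ∧ Spells lab I q k w' d := by
  induction w generalizing c with
  | nil => simp [Spells]
  | cons t w ih =>
    simp only [List.cons_append, Spells, ih]
    constructor
    · rintro ⟨e, h1, h2, k, h3, h4⟩
      exact ⟨k, ⟨e, h1, h2, h3⟩, h4⟩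
    · rintro ⟨k, ⟨e, h1, h2, h3⟩, h4⟩
      exact ⟨e, h1, h2, k, h3, h4⟩

omit H in
theorem _root_.EventStructure.Spells.isConfiguration
    {w : List (CellTransition L Q × Bool)} {c d : Finset E}
    (h : Spells lab I q c w d) (hc : S.IsConfiguration c) : S.IsConfiguration d := by
  induction w generalizing c with
  | nil => exact h ▸ hc
  | cons t w ih =>
    obtain ⟨e, he, -, h⟩ := h
    exact ih h (hc.insert he)

include H in
theorem spells_unique {w : List (CellTransition L Q × Bool)}
    {c d d' : Finset E} (h : Spells lab I q c w d) (h' : Spells lab I q c w d') : d = d' := by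
  induction w generalizing c with
  | nil => exact h.symm.trans h'
  | cons t w ih =>
    obtain ⟨e, he, rfl, h⟩ := h
    obtain ⟨f, hf, hef, h'⟩ := h'
    obtain rfl : f = e := H.enabled_unique hf he (congrArg (fun t => t.1.1) hef)
    exact ih h h'

theorem spells_swap {w w' : List (CellTransition L Q × Bool)}
    {c d : Finset E} (hc : S.IsConfiguration c) (h : Spells lab I q c w d)
    (hw : (H.system q).Swap w w') : Spells lab I q c w' d := by
  obtain ⟨u, z, t, t', hI, rfl, rfl⟩ := hw
  obtain ⟨k, h12, h3⟩ := spells_append.1 h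
  obtain ⟨l, h1, e, he, rfl, f, hf, rfl, h2⟩ := spells_append.1 h12
  obtain ⟨h4, h5⟩ := H.enabled_swap (h1.isConfiguration hc) he hf hI
  refine spells_append.2 ⟨k, spells_append.2 ⟨l, h1, f, h4, rfl, e, h5, rfl, ?_⟩, h3⟩
  rw [Finset.insert_comm]
  exact h2

theorem exists_spells (hc : S.IsConfiguration c) :
    ∃ w, Spells lab I q ∅ w c ∧ (H.system q).pile w = H.piling q c := by
  refine hc.induction (P := fun c => ∃ w, Spells lab I q ∅ w c ∧ (H.system q).pile w = H.piling q c)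
    ⟨[], rfl, H.piling_empty.symm⟩ ?_
  rintro d e hd he ⟨w, h1, h2⟩
  exact ⟨w ++ [(transition lab I q e, true)], spells_append.2 ⟨d, h1, e, he, rfl, rfl⟩, by
    rw [pile_append_singleton, h2, H.piling_insert hd he]⟩

/-- Words with equal pilings differ by exchanges, which preserve the configuration spelled from `∅`;
and a word spells at most one configuration, because labels determine enabled events. -/
theorem piling_injective {c c' : Finset E} (hc : S.IsConfiguration c) (hc' : S.IsConfiguration c')
    (h : H.piling q c = H.piling q c') : c = c' := by
  obtain ⟨w, h1, h2⟩ := H.exists_spells  hc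
  obtain ⟨w', h3, h4⟩ := H.exists_spells  hc'
  have hs := swapEq_of_pile_eq (h2.trans (h.trans h4.symm))
  suffices h5 : Spells lab I q ∅ w' c from H.spells_unique h5 h3
  clear h3 h4 h h2
  induction hs with
  | refl => exact h1
  | tail _ h ih => exact H.spells_swap isConfiguration_empty ih h

variable (q) in
/-- The state of the unfolding that corresponds to a configuration. -/
noncomputable def unfold (c : S.Domain) : (H.system q).unfolding.V :=
  (cells lab q c.1, ⟨H.piling q c.1, H.validPiling_piling c.2⟩)

theorem step_unfold (c : S.Domain) (he : S.Enabled c.1 e) :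
    (H.system q).unfolding.step (H.unfold q c) (transition lab I q e, true)
      (H.unfold q (c.add he)) :=
  ⟨H.step_cells c.2 he, (H.act_piling c.2 he).symm⟩

variable (q) in
/-- The base point of the unfolding. -/
noncomputable def base : (H.system q).unfolding.V :=
  (cells lab q (∅ : Finset E), ⟨_, validPiling_nil⟩)

theorem unfold_empty : H.unfold q ⟨∅, isConfiguration_empty⟩ = H.base q :=
  Prod.ext rfl (Subtype.ext H.piling_empty)

variable (q) in
/-- The existence of a sequence of positive steps. -/
def PosReach : (H.system q).unfolding.V → (H.system q).unfolding.V → Prop :=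
  Relation.ReflTransGen fun v w => ∃ t, (H.system q).unfolding.step v (t, true) w

theorem posReach_of_le {c d : S.Domain} (h : c ≤ d) :
    H.PosReach q (H.unfold q c) (H.unfold q d) := by
  obtain ⟨d, hd⟩ := d
  refine IsConfiguration.induction_of_subset (c := c.1)
    (P := fun d => ∀ hd : S.IsConfiguration d, H.PosReach q (H.unfold q c) (H.unfold q ⟨d, hd⟩))
    (fun _ => .refl) (fun d e _ hd he ih hd' => ?_) c.2 hd h hd
  exact (ih hd).tail ⟨_, H.step_unfold ⟨d, hd⟩ he⟩

theorem exists_of_posReach [Finite L]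
    (hq : ∀ c c', q c = q c' ↔ S.labeledFutureSetoid lab c c') {c : S.Domain}
    {v : (H.system q).unfolding.V} (h : H.PosReach q (H.unfold q c) v) :
    ∃ d, c ≤ d ∧ H.unfold q d = v := by
  induction h with
  | refl => exact ⟨c, le_rfl, rfl⟩
  | tail _ h ih =>
    obtain ⟨d, hd, rfl⟩ := ih
    obtain ⟨t, h⟩ := h
    obtain ⟨e, he, rfl⟩ := H.exists_enabled_of_step hq d.2 h.1
    refine ⟨d.add he, hd.trans (Finset.subset_insert _ _), ?_⟩
    exact (H.system q).unfolding.step_det (H.step_unfold d he) h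

theorem unfold_injective : Function.Injective (H.unfold q) := fun c d h =>
  Subtype.ext (H.piling_injective c.2 d.2 (congrArg (fun v => v.2.1) h))

end IsTrace

end

end EventStructure

/-! ### The domain as a principal filter of the universal cover -/

namespace EventStructure

open IndependenceSystem CubeComplex

variable {E : Type u} [PartialOrder E] {S : EventStructure E}
variable {L : Type} {lab : E → L} {I : L → L → Prop} {Q : Type} {q : S.Domain → Q}

namespace IsTrace

variable (H : S.IsTrace lab I)

theorem PosReach.connected {v w : (H.system q).unfolding.V} (h : H.PosReach q v w) :
    (H.system q).unfolding.Connected v w :=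
  Relation.ReflTransGen.mono (fun _ _ ⟨t, h⟩ => ⟨(t, true), h⟩) _ _ h

theorem posReach_base (c : S.Domain) : H.PosReach q (H.base q) (H.unfold q c) := by
  rw [← H.unfold_empty]
  exact H.posReach_of_le (Finset.empty_subset c.1)

theorem reach_iff {v w : ((H.system q).cover (H.base q).1).V} :
    ((H.system q).cover (H.base q).1).orientation.Reach
      (((H.system q).cover (H.base q).1).vertex v)
      (((H.system q).cover (H.base q).1).vertex w) ↔ H.PosReach q v.1 w.1 := by
  rw [reach_orientation, vtx₀_vertex, vtx₀_vertex]
  constructor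
  · exact fun h => Relation.ReflTransGen.lift
      (p := fun v w => ∃ t, (H.system q).unfolding.step v (t, true) w) Subtype.val
      (fun _ _ h => h) _ _ h
  · obtain ⟨w, hw⟩ := w
    intro h
    change H.PosReach q v.1 w at h
    induction h with
    | refl => exact .refl
    | tail h1 h2 ih =>
      exact (ih (v.2.trans (PosReach.connected H h1))).tail h2

/-- The domain of a trace event structure with finitely many futures is a principal filter of the
universal cover of the complex of its cells. -/
theorem domainIsFilter [Finite L] (hq : ∀ c c', q c = q c' ↔ S.labeledFutureSetoid lab c c') :
    S.DomainIsFilterOfUniversalCover ((H.system q).component (H.base q).1).complex := by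
  let N := (H.system q).cover (H.base q).1
  let b : N.V := ⟨H.base q, .refl⟩
  let G : S.Domain → N.V := fun c => ⟨H.unfold q c, PosReach.connected H (H.posReach_base c)⟩
  refine ⟨((H.system q).component (H.base q).1).orientation, _, (H.system q).coverHom (H.base q).1,
    N.vertex b,
    isUniversalCover_coverHom _ _, ?_⟩
  rw [lift_orientation]
  let F : S.Domain → N.orientation.Filter (N.vertex b) := fun c =>
    ⟨N.vertex (G c), H.reach_iff.2 (H.posReach_base c)⟩
  have hle : ∀ c d, N.orientation.Reach (F c).1 (F d).1 ↔ c ≤ d := by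
    intro c d
    refine H.reach_iff.trans ⟨fun h => ?_, fun h => H.posReach_of_le h⟩
    -- A positive path from the state of `c` ends at the state of some configuration above `c`;
    -- since pilings separate configurations, this one is `d`.
    obtain ⟨d', h1, h2⟩ := H.exists_of_posReach hq h
    rwa [← H.unfold_injective h2]
  have hinj : Function.Injective F := fun c d h => by
    refine le_antisymm ((hle c d).1 ?_) ((hle d c).1 ?_) <;> rw [h] <;> exact .refl
  have hsurj : Function.Surjective F := by
    rintro ⟨x, hx⟩
    rw [← vertex_vtx₀ x] at hx
    have h1 : H.PosReach q (H.base q) (vtx₀ x).1 := H.reach_iff.1 hx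
    obtain ⟨c, -, hc⟩ := H.exists_of_posReach hq (c := ⟨∅, isConfiguration_empty⟩)
      (v := (vtx₀ x).1) (by rw [H.unfold_empty]; exact h1)
    exact ⟨c, Subtype.ext (vtx₀_injective (Subtype.ext hc))⟩
  exact ⟨⟨Equiv.ofBijective F ⟨hinj, hsurj⟩, fun {c d} => hle c d⟩⟩

theorem isVirtuallySpecial [Finite L] [Finite Q] :
    ((H.system q).component (H.base q).1).complex.IsVirtuallySpecial := by
  have : Finite (Info L (Set Q)) := inferInstanceAs
    (Finite ((L → L → Option (Option L)) × (L → L → Prop) × (Set L → Set Q → Set Q)))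
  have : Finite (H.system q).V := inferInstanceAs (Finite (L → Info L (Set Q)))
  have : Finite ((H.system q).component (H.base q).1).V := Subtype.finite
  exact isVirtuallySpecial_complex

end IsTrace

end EventStructure

theorem mainTheorem6 {E : Type u} [PartialOrder E] (S : EventStructure E)
    (hS : S.IsTraceRegular) : S.IsCoverSpecial ∧ S.IsStronglyRegular := by
  obtain ⟨L, _, _, I, lab, hirr, hsymm, hlab, hfin⟩ := hS
  have H : S.IsTrace lab I := ⟨hlab, hirr, hsymm⟩
  have : Finite (Quotient (S.labeledFutureSetoid lab)) := hfin
  -- The quotient lives in the universe of `E`; numbering its classes gives a set of futures in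
  -- `Type`, where the complexes are built.
  obtain ⟨n, ⟨φ⟩⟩ := Finite.exists_equiv_fin (Quotient (S.labeledFutureSetoid lab))
  have hq : ∀ c c' : S.Domain, φ (Quotient.mk _ c) = φ (Quotient.mk _ c') ↔
      S.labeledFutureSetoid lab c c' := fun c c' => φ.apply_eq_iff_eq.trans Quotient.eq
  have hF := H.domainIsFilter hq
  have hV := H.isVirtuallySpecial (q := fun c => φ (Quotient.mk _ c))
  exact ⟨⟨⟨_, hV.1, hV.2.1, hF⟩, _, hV, hF⟩, _, hV.1, hV.2.1, hF⟩
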